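/- Consider instances consisting of a simple undirected graph $G=(V,E)$ with $n$ vertices, an edge colouring $\chi:E\to\{1,\dots,\ell\}$, and rational numbers $0\le\alpha\le\beta\le1$. For a colour $c$ let $E_c=\chi^{-1}(c)$. A non-empty set $M\subseteq E$ is an $(\alpha,\beta)$-balanced matching if no two edges of $M$ share a vertex and $\alpha\le |M\cap E_c|/|M|\le\beta$ for every $c\in\{1,\dots,\ell\}$. There are a deterministic algorithm and a constant $c_0$ such that, given any such instance and any integer $k\ge1$, the algorithm either outputs an $(\alpha,\beta)$-balanced matching of size exactly $k$ or correctly reports that none exists, within $c_0\,2^{c_0k}(n+1)^{c_0}$ steps, that is, in $2^{O(k)}n^{O(1)}$ time. Here the algorithm is a program for the unit-cost random access machine whose arithmetic is addition and truncated subtraction of natural numbers, and the input is the list $n,\ell,k$, the numerators and denominators of $\alpha$ and $\beta$, and the coloured adjacency matrix of $G$. Consequently, deciding whether an $(\alpha,\beta)$-balanced matching of size $k$ exists is fixed-parameter tractable with parameter $k$: for some computable function $f$ and some constant $c_1$, it is decided by one such program in at most $f(k)\cdot N^{c_1}$ steps, where $N$ is the length of the input list. -/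

import Mathlib

namespace FairMatching

/-! ### Random access machines

Deterministic random access machines with unbounded registers and finitely many (per program)
memory arrays of natural numbers. The only arithmetic is addition and truncated subtraction (no
multiplication, shifts or bit operations), and every instruction and every test costs one step:
the standard unit-cost model, polynomially equivalent to Turing machines. -/

/-- Programs. Registers and arrays are named by natural-number constants. -/
inductive Prog : Type
  /-- `reg r := v` -/
  | const (r v : ℕ) : Prog
  /-- `reg r := reg i + reg j` -/
  | add (r i j : ℕ) : Prog
  /-- `reg r := reg i - reg j` (truncated) -/
  | sub (r i j : ℕ) : Prog
  /-- `reg r := a[reg i]` -/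
  | load (r a i : ℕ) : Prog
  /-- `a[reg i] := reg j` -/
  | store (a i j : ℕ) : Prog
  /-- sequential composition -/
  | seq (p q : Prog) : Prog
  /-- `if reg i < reg j then p else q` -/
  | ifLt (i j : ℕ) (p q : Prog) : Prog
  /-- `while reg i < reg j do p` -/
  | whileLt (i j : ℕ) (p : Prog) : Prog

/-- A machine state: the contents of the registers and of the arrays (`mem a i` is `a[i]`). -/
structure State : Type where
  reg : ℕ → ℕ
  mem : ℕ → ℕ → ℕ

/-- The state after writing `v` to register `r`. -/
def State.setReg (s : State) (r v : ℕ) : State :=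
  { s with reg := Function.update s.reg r v }

/-- The state after writing `v` to cell `i` of array `a`. -/
def State.setMem (s : State) (a i v : ℕ) : State :=
  { s with mem := Function.update s.mem a (Function.update (s.mem a) i v) }

/-- `Exec p s t s'`: started in state `s`, the program `p` halts after exactly `t` steps,
in state `s'`. -/
inductive Exec : Prog → State → ℕ → State → Prop
  | const (s : State) (r v : ℕ) : Exec (.const r v) s 1 (s.setReg r v)
  | add (s : State) (r i j : ℕ) : Exec (.add r i j) s 1 (s.setReg r (s.reg i + s.reg j))
  | sub (s : State) (r i j : ℕ) : Exec (.sub r i j) s 1 (s.setReg r (s.reg i - s.reg j))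
  | load (s : State) (r a i : ℕ) : Exec (.load r a i) s 1 (s.setReg r (s.mem a (s.reg i)))
  | store (s : State) (a i j : ℕ) : Exec (.store a i j) s 1 (s.setMem a (s.reg i) (s.reg j))
  | seq {p q : Prog} {s s' s'' : State} {t t' : ℕ} (hp : Exec p s t s') (hq : Exec q s' t' s'') :
      Exec (.seq p q) s (t + t') s''
  | ifLt_true {i j : ℕ} {p q : Prog} {s s' : State} {t : ℕ} (h : s.reg i < s.reg j)
      (hp : Exec p s t s') : Exec (.ifLt i j p q) s (t + 1) s'
  | ifLt_false {i j : ℕ} {p q : Prog} {s s' : State} {t : ℕ} (h : ¬ s.reg i < s.reg j)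
      (hq : Exec q s t s') : Exec (.ifLt i j p q) s (t + 1) s'
  | whileLt_true {i j : ℕ} {p : Prog} {s s' s'' : State} {t t' : ℕ} (h : s.reg i < s.reg j)
      (hp : Exec p s t s') (hw : Exec (.whileLt i j p) s' t' s'') :
      Exec (.whileLt i j p) s (t + t' + 1) s''
  | whileLt_false {i j : ℕ} {p : Prog} {s : State} (h : ¬ s.reg i < s.reg j) :
      Exec (.whileLt i j p) s 1 s

/-- The initial state on input `x`: the words of `x` in array `0`, the length of `x` in
register `0`, and zeros everywhere else. -/
def State.init (x : List ℕ) : State where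
  reg r := if r = 0 then x.length else 0
  mem a i := if a = 0 then x.getD i 0 else 0

/-- The output of a final state: the first `reg 0` words of array `1`. -/
def State.output (s : State) : List ℕ := (List.range (s.reg 0)).map (s.mem 1)

/-- On input `x`, the program `p` halts after exactly `t` steps with output `y`. -/
def Prog.Outputs (p : Prog) (x : List ℕ) (t : ℕ) (y : List ℕ) : Prop :=
  ∃ s : State, Exec p (State.init x) t s ∧ s.output = y

/-- Fixed-parameter tractability of the decision problem `Yes` on instances of type `ι`, encoded
by `enc`, with parameter `κ`: a single program decides it in at most `f (κ x) * |enc x| ^ c` steps,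
for a computable `f` and a constant `c`. -/
def IsFPT {ι : Type} (enc : ι → List ℕ) (κ : ι → ℕ) (Yes : ι → Prop) : Prop :=
  ∃ (p : Prog) (f : ℕ → ℕ) (c : ℕ), Computable f ∧
    ∀ x : ι, ∃ (t : ℕ) (y : List ℕ), p.Outputs (enc x) t y ∧
      t ≤ f (κ x) * (enc x).length ^ c ∧
      ((Yes x ∧ y = [1]) ∨ (¬ Yes x ∧ y = [0]))

/-! ### Proportionally fair matching -/

/-- An instance: a simple graph on the vertex set `Fin n`, a colouring `χ` of its edges with `ℓ`
colours, and rational bounds `0 ≤ α ≤ β ≤ 1`. -/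
structure Instance : Type where
  n : ℕ
  ℓ : ℕ
  G : SimpleGraph (Fin n)
  χ : G.edgeSet → Fin ℓ
  α : ℚ
  β : ℚ
  α_nonneg : 0 ≤ α
  α_le_β : α ≤ β
  β_le_one : β ≤ 1

namespace Instance

variable (I : Instance)

/-- `E_c`, the set of edges of colour `c`. -/
def colorClass (c : Fin I.ℓ) : Set (Sym2 (Fin I.n)) :=
  {e | ∃ h : e ∈ I.G.edgeSet, I.χ ⟨e, h⟩ = c}

/-- `M` is a set of edges of the graph, no two of which share a vertex. -/
def IsMatching (M : Finset (Sym2 (Fin I.n))) : Prop :=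
  (∀ e ∈ M, e ∈ I.G.edgeSet) ∧ ∀ e ∈ M, ∀ e' ∈ M, e ≠ e' → ∀ v, ¬ (v ∈ e ∧ v ∈ e')

/-- `M` is an `(α, β)`-balanced matching. (Only used for nonempty `M`.) -/
def IsBalancedMatching (M : Finset (Sym2 (Fin I.n))) : Prop :=
  I.IsMatching M ∧ ∀ c : Fin I.ℓ,
    I.α ≤ (((M : Set (Sym2 (Fin I.n))) ∩ I.colorClass c).ncard : ℚ) / (M.card : ℚ) ∧
    (((M : Set (Sym2 (Fin I.n))) ∩ I.colorClass c).ncard : ℚ) / (M.card : ℚ) ≤ I.β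

/-- There is an `(α, β)`-balanced matching of size exactly `k`. -/
def HasSolution (k : ℕ+) : Prop :=
  ∃ M : Finset (Sym2 (Fin I.n)), I.IsBalancedMatching M ∧ M.card = (k : ℕ)

open Classical in
/-- Entry of the coloured adjacency matrix: `0` if `u`, `v` are not adjacent, and otherwise the
colour of the edge `uv`, where the colours are numbered `1, …, ℓ`. -/
noncomputable def entry (u v : Fin I.n) : ℕ :=
  if h : s(u, v) ∈ I.G.edgeSet then (I.χ ⟨s(u, v), h⟩ : ℕ) + 1 else 0

/-- The input of the algorithm: `n`, `ℓ`, `k`, then `α` and `β` as reduced fractions, then the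
coloured adjacency matrix, row by row. -/
noncomputable def encode (k : ℕ+) : List ℕ :=
  [I.n, I.ℓ, (k : ℕ), I.α.num.toNat, I.α.den, I.β.num.toNat, I.β.den] ++
    List.ofFn fun i : Fin (I.n * I.n) => I.entry i.divNat i.modNat

/-- `y` is a correct output: either `1, u₁, v₁, …, u_k, v_k`, listing the distinct edges
`u₁v₁, …, u_kv_k` of a balanced matching of size `k`, or the single word `0`, and there is no such
matching. -/
def IsCorrectOutput (k : ℕ+) (y : List ℕ) : Prop :=
  (∃ L : List (Fin I.n × Fin I.n),
    L.length = (k : ℕ) ∧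
    (L.map fun e => s(e.1, e.2)).Nodup ∧
    I.IsBalancedMatching (L.map fun e => s(e.1, e.2)).toFinset ∧
    y = 1 :: L.flatMap fun e => [(e.1 : ℕ), (e.2 : ℕ)]) ∨
  (¬ I.HasSolution k ∧ y = [0])

end Instance

end FairMatching

namespace FairMatching

open Finset

/-! The algorithm is algebraic: one integer, computed in an exterior algebra of dimension `2 ^ (4 *
k)`, tells whether a solution exists.

Put `K = 2 * k` and `D = 2 * K`. A vertex `v` has the moment vector `(1, v, …, v ^ (K - 1))`. Place
one copy of it on the even and one on the odd coordinates of `ℤ ^ D`, and represent `v` by the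
exterior product of the two copies. For `K` vertices, the coefficient of the top basis element in
the product of their representatives is a sign that depends only on `D`, times the square of a
Vandermonde determinant (`det_momentRow`, `topCoeff_vertexVec`). So it vanishes if a vertex is
repeated and otherwise has that fixed sign; for a list of any other length it vanishes by degree.
Sums over families of vertex lists therefore cannot cancel (`topCoeff_wordSum_ne_zero_iff`).

The family needed consists of the words of edges that take, colour by colour, an admissible number
of edges of each colour. It is never enumerated. By distributivity (`wordSum_map_cons`) its sum
arises from repeated multiplication by the sum of all edges of the current colour, and the top
coefficient of the result is nonzero exactly if some word is a solution of size `k`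
(`topCoeff_words_ne_zero_iff`). The degree alone enforces the size.

Registers hold natural numbers, so an element of the algebra is stored by `2 ^ (D + 1)` natural
coefficients, one for each signed basis element; the two top coefficients are only compared, never
subtracted. The number of colours is not bounded in terms of `n`. Only colours that occur on edges
are processed, and a colour that does not occur is harmless exactly if the lower bound is zero
(`allowed_colours_iff`).

A matching is found by self-reduction: each edge in turn is deleted and restored if solvability is
lost. What remains is minimal and hence is itself a solution (`isSolutionWord_of_minimal`). All loop
lengths are at most `B = 2 ^ (4 * k + 1) * (n + 1) ^ 2` and loops are nested seven deep, which gives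
the bound `O(B ^ 7)`. -/

/-! ### Signed basis elements of an exterior algebra, coded in binary -/

/-- Scanning the binary digits of `X` from position `D` downwards. -/
def scan (D X : ℕ) : ℕ → ℕ × ℕ
  | 0 => if X < 2 ^ D then (X, 0) else (X - 2 ^ D, 2 ^ D)
  | d + 1 =>
    if (scan D X d).1 < 2 ^ (D - 1 - d) then scan D X d
    else ((scan D X d).1 - 2 ^ (D - 1 - d), 2 ^ D - (scan D X d).2)

/-- Insertion of the basis vector `i` into the signed basis element coded by `X`; the value
`2 ^ (D + 1)` stands for zero. -/
def nx (D i X : ℕ) : ℕ :=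
  if (scan D X (D - 1 - i)).1 < 2 ^ i then
    (scan D X 0).1 + 2 ^ i + (scan D X (D - 1 - i)).2
  else 2 ^ (D + 1)

/-- The code of the set `S` with the sign `(-1) ^ v`. -/
def code (D : ℕ) (S : Finset ℕ) (v : ℕ) : ℕ := ∑ j ∈ S, 2 ^ j + (v % 2) * 2 ^ D

theorem sum_two_pow_lt {D : ℕ} {S : Finset ℕ} (hS : ∀ j ∈ S, j < D) : ∑ j ∈ S, 2 ^ j < 2 ^ D :=
  Nat.geomSum_lt le_rfl hS

theorem code_lt {D : ℕ} {S : Finset ℕ} (hS : ∀ j ∈ S, j < D) (v : ℕ) :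
    code D S v < 2 ^ (D + 1) := by
  have h := sum_two_pow_lt hS
  have h2 : v % 2 * 2 ^ D ≤ 1 * 2 ^ D := Nat.mul_le_mul_right _ (by omega)
  rw [code, pow_succ]; omega

/-- Step `0` splits off the sign digit at position `D`. Each further step strips one digit of `S`,
and a digit `1` flips the sign word between `0` and `2 ^ D`. So the first component is what is left
of `S`, and the second records the parity of what was removed. -/
theorem scan_code {D : ℕ} {S : Finset ℕ} (hS : ∀ j ∈ S, j < D) (v : ℕ) (d : ℕ) (hd : d ≤ D) :
    scan D (code D S v) d = (∑ j ∈ S with j < D - d, 2 ^ j,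
      ((v + #{j ∈ S | D - d ≤ j}) % 2) * 2 ^ D) := by
  induction d with
  | zero =>
    have h1 : S.filter (fun j => j < D - 0) = S := filter_true_of_mem (by simpa using hS)
    have h2 : S.filter (fun j => D - 0 ≤ j) = ∅ :=
      filter_false_of_mem (by simpa using hS)
    have h := sum_two_pow_lt hS
    rw [h1, h2, scan, code]
    rcases Nat.mod_two_eq_zero_or_one v with h0 | h0 <;> simp [h0, h]
  | succ d ih =>
    have hi := ih (by omega)
    obtain ⟨a, ha⟩ : ∃ a, D = a + d + 1 := ⟨D - d - 1, by omega⟩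
    have e1 : D - 1 - d = a := by omega
    have e2 : D - d = a + 1 := by omega
    have e3 : D - (d + 1) = a := by omega
    rw [e2] at hi
    rw [scan, hi, e1, e3]
    have hlt : ∑ j ∈ S with j < a, 2 ^ j < 2 ^ a :=
      sum_two_pow_lt (fun j hj => (mem_filter.1 hj).2)
    by_cases haS : a ∈ S
    · have f1 : S.filter (fun j => j < a + 1) = insert a (S.filter (fun j => j < a)) := by
        ext j; simp only [mem_filter, mem_insert]
        constructor
        · rintro ⟨h1, h2⟩; by_cases h : j = a
          · exact Or.inl h
          · exact Or.inr ⟨h1, by omega⟩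
        · rintro (rfl | ⟨h1, h2⟩)
          · exact ⟨haS, by omega⟩
          · exact ⟨h1, by omega⟩
      have f2 : S.filter (fun j => a ≤ j) = insert a (S.filter (fun j => a + 1 ≤ j)) := by
        ext j; simp only [mem_filter, mem_insert]
        constructor
        · rintro ⟨h1, h2⟩; by_cases h : j = a
          · exact Or.inl h
          · exact Or.inr ⟨h1, by omega⟩
        · rintro (rfl | ⟨h1, h2⟩)
          · exact ⟨haS, by omega⟩
          · exact ⟨h1, by omega⟩
      rw [f1, f2, sum_insert (by simp), card_insert_of_notMem (by simp)]
      rw [if_neg (by simp)]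
      ext
      · simp
      · simp only
        rcases Nat.mod_two_eq_zero_or_one (v + #(S.filter (fun j => a + 1 ≤ j))) with h0 | h0
        · rw [h0, ← add_assoc, Nat.add_mod, h0]; simp
        · rw [h0, ← add_assoc, Nat.add_mod, h0]; simp
    · have f1 : S.filter (fun j => j < a + 1) = S.filter (fun j => j < a) := by
        apply filter_congr; intro j hj
        have : j ≠ a := fun h => haS (h ▸ hj)
        omega
      have f2 : S.filter (fun j => a ≤ j) = S.filter (fun j => a + 1 ≤ j) := by
        apply filter_congr; intro j hj
        have : j ≠ a := fun h => haS (h ▸ hj)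
        omega
      rw [f1, f2, if_pos hlt]

/-- Basis elements are products of basis vectors in decreasing order, and `i` is multiplied from the
left, so it has to pass exactly the elements of `S` above `i`. Once these are stripped, the
remainder reaches `2 ^ i` exactly if `i ∈ S`, in which case the product is zero. -/
theorem nx_code {D : ℕ} {S : Finset ℕ} (hS : ∀ j ∈ S, j < D) (v : ℕ) {i : ℕ} (hi : i < D) :
    nx D i (code D S v) =
      if i ∈ S then 2 ^ (D + 1) else code D (insert i S) (v + #{j ∈ S | i < j}) := by
  have e : D - (D - 1 - i) = i + 1 := by omega
  rw [nx, scan_code hS v _ (by omega), scan_code hS v 0 (by omega), e]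
  simp only
  by_cases hiS : i ∈ S
  · rw [if_pos hiS, if_neg]
    rw [not_lt]
    exact single_le_sum (f := fun j => 2 ^ j) (fun _ _ => Nat.zero_le _)
      (mem_filter.2 ⟨hiS, by omega⟩)
  · rw [if_neg hiS, if_pos, filter_true_of_mem (by simpa using hS), code, sum_insert hiS]
    · simp only [Nat.succ_le_iff]; ring
    · apply sum_two_pow_lt
      intro j hj
      have h1 := mem_filter.1 hj
      have : j ≠ i := fun h => hiS (h ▸ h1.1)
      omega

/-- Insertion of a list of basis vectors, the last one first. -/
def walk (D : ℕ) : List ℕ → ℕ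
  | [] => 0
  | i :: l => if walk D l < 2 ^ (D + 1) then nx D i (walk D l) else 2 ^ (D + 1)

/-- The number of pairs of entries that are in increasing order. -/
def invCount : List ℕ → ℕ
  | [] => 0
  | i :: l => invCount l + l.countP (fun j => i < j)

/-- Sorting a product of basis vectors into decreasing order costs one sign for each increasing
pair, and a repeated factor gives zero, which is absorbing. -/
theorem walk_eq {D : ℕ} (l : List ℕ) (hl : ∀ i ∈ l, i < D) :
    walk D l = if l.Nodup then code D l.toFinset (invCount l) else 2 ^ (D + 1) := by
  induction l with
  | nil => simp [walk, code, invCount]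
  | cons i l ih =>
    have ih' := ih (fun j hj => hl j (List.mem_cons_of_mem _ hj))
    have hS : ∀ j ∈ l.toFinset, j < D := fun j hj => hl j (List.mem_cons_of_mem _ (by simpa using hj))
    rw [walk, ih']
    by_cases hn : l.Nodup
    · rw [if_pos hn, if_pos (code_lt hS _), nx_code hS _ (hl i (by simp))]
      by_cases hi : i ∈ l
      · simp [hi]
      · have : #{j ∈ l.toFinset | i < j} = l.countP (fun j => i < j) := by
          have e : ({j ∈ l.toFinset | i < j} : Finset ℕ) =
              (l.filter (fun j => i < j)).toFinset := by ext; simp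
          rw [e, List.toFinset_card_of_nodup (hn.filter _), List.countP_eq_length_filter]
        simp only [List.mem_toFinset, hi, if_false, List.nodup_cons, not_false_eq_true, hn,
          and_self, if_true, List.toFinset_cons, invCount, this]
    · simp [hn]

/-! ### Coefficient vectors of exterior products; the top coefficient is a determinant -/

/-- The linear map on coefficient vectors induced by the insertion of `i`. -/
def push (D i : ℕ) (f : ℕ → ℕ) (Y : ℕ) : ℕ :=
  ∑ X ∈ range (2 ^ (D + 1)), if nx D i X = Y then f X else 0

/-- The coefficient vector of an exterior product of row vectors. -/
def rowVec (D : ℕ) : List (ℕ → ℕ) → ℕ → ℕ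
  | [] => fun Y => if Y = 0 then 1 else 0
  | y :: ys => fun Y => ∑ i ∈ range D, y i * push D i (rowVec D ys) Y

/-- Multilinear expansion: choose one coordinate `p t` in every row. The hypothesis on `Y` excludes
the code of zero, which `push` does not propagate. -/
theorem rowVec_eq {D : ℕ} {m : ℕ} (y : Fin m → ℕ → ℕ) {Y : ℕ} (hY : Y < 2 ^ (D + 1)) :
    rowVec D (List.ofFn y) Y = ∑ p : Fin m → Fin D,
      if walk D (List.ofFn fun t => (p t : ℕ)) = Y then ∏ t, y t (p t) else 0 := by
  induction m generalizing Y with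
  | zero => simp [rowVec, walk, eq_comm]
  | succ m ih =>
    rw [List.ofFn_succ, ← (Fin.consEquiv (fun _ => Fin D)).sum_comp, Fintype.sum_prod_type]
    simp only [rowVec]
    rw [Finset.sum_range]
    refine sum_congr rfl fun i _ => ?_
    rw [push, mul_sum]
    have : ∀ X ∈ range (2 ^ (D + 1)),
        (y 0 i * if nx D i X = Y then rowVec D (List.ofFn fun t => y t.succ) X else 0) =
        ∑ p : Fin m → Fin D, if nx D i X = Y ∧ walk D (List.ofFn fun t => (p t : ℕ)) = X then
          y 0 i * ∏ t, y t.succ (p t) else 0 := by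
      intro X hX
      rw [ih _ (mem_range.1 hX)]
      by_cases h : nx D i X = Y
      · simp [h, mul_sum]
      · simp [h]
    rw [sum_congr rfl this, sum_comm]
    refine sum_congr rfl fun p _ => ?_
    simp only [Fin.consEquiv_apply, List.ofFn_succ, Fin.cons_zero, Fin.cons_succ, walk,
      Fin.prod_univ_succ]
    by_cases hw : walk D (List.ofFn fun t => (p t : ℕ)) < 2 ^ (D + 1)
    · rw [if_pos hw, sum_eq_single (walk D (List.ofFn fun t => (p t : ℕ)))]
      · simp
      · intro X _ hX
        rw [if_neg]
        exact fun h => hX h.2.symm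
      · intro h; exact absurd (mem_range.2 hw) h
    · rw [if_neg hw, if_neg (by omega)]
      refine sum_eq_zero fun X hX => if_neg ?_
      rintro ⟨-, rfl⟩
      exact hw (mem_range.1 hX)

/-- The signed coefficient of the top-dimensional basis element. -/
def topCoeff (D : ℕ) (f : ℕ → ℕ) : ℤ := (f (2 ^ D - 1) : ℤ) - f (2 ^ (D + 1) - 1)

theorem neg_one_pow_countP {m : ℕ} (a : ℕ) (q : Fin m → ℕ) :
    (-1 : ℤ) ^ (List.ofFn q).countP (fun j => a < j) = ∏ j, if a < q j then -1 else 1 := by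
  induction m with
  | zero => simp
  | succ m ih =>
    rw [List.ofFn_succ, List.countP_cons, pow_add, ih, Fin.prod_univ_succ, mul_comm]
    split_ifs with h <;> simp_all

theorem neg_one_pow_invCount {m : ℕ} (p : Fin m → ℕ) :
    (-1 : ℤ) ^ invCount (List.ofFn p) =
      ∏ t, ∏ t' ∈ Ioi t, if p t < p t' then -1 else 1 := by
  induction m with
  | zero => simp [invCount]
  | succ m ih =>
    rw [List.ofFn_succ, invCount, pow_add, ih, Fin.prod_univ_succ, mul_comm]
    simp only [Fin.prod_Ioi_succ, Fin.prod_Ioi_zero]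
    rw [neg_one_pow_countP]

theorem code_eq_full {D : ℕ} {S : Finset ℕ} (hS : ∀ j ∈ S, j < D) (v : ℕ)
    (h : code D S v = 2 ^ D - 1 ∨ code D S v = 2 ^ (D + 1) - 1) : S = range D := by
  have h1 := sum_two_pow_lt hS
  have hpos : 0 < 2 ^ D := by positivity
  have h2 : ∑ j ∈ S, 2 ^ j = 2 ^ D - 1 := by
    rw [code, pow_succ] at h
    rcases Nat.mod_two_eq_zero_or_one v with h0 | h0 <;> rw [h0] at h <;> omega
  have h3 : ∑ j ∈ range D, 2 ^ j = 2 ^ D - 1 := by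
    rw [Nat.geomSum_eq le_rfl]; simp
  exact Finset.geomSum_injective le_rfl (by simp [h2, h3])

theorem code_range (D v : ℕ) : code D (range D) v = 2 ^ D - 1 + (v % 2) * 2 ^ D := by
  rw [code, Nat.geomSum_eq le_rfl]; simp

/-- A degree argument: `m` distinct basis vectors form a set of size `m`, while both top codes stand
for the full set of size `D`. -/
theorem topCoeff_rowVec_eq_zero {D : ℕ} {m : ℕ} (hm : m ≠ D) (y : Fin m → ℕ → ℕ) :
    topCoeff D (rowVec D (List.ofFn y)) = 0 := by
  have hpos : 0 < 2 ^ D := by positivity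
  have key : ∀ Y, Y = 2 ^ D - 1 ∨ Y = 2 ^ (D + 1) - 1 → rowVec D (List.ofFn y) Y = 0 := by
    intro Y hY
    rw [rowVec_eq y (by rw [pow_succ] at *; omega)]
    refine sum_eq_zero fun p _ => if_neg fun h => hm ?_
    have hl : ∀ i ∈ List.ofFn (fun t => (p t : ℕ)), i < D := by
      intro i hi; obtain ⟨t, rfl⟩ := (List.mem_ofFn' _ _).1 hi; exact (p t).2
    rw [walk_eq _ hl] at h
    split_ifs at h with hn
    · have hS := code_eq_full (S := (List.ofFn (fun t => (p t : ℕ))).toFinset)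
        (fun j hj => hl j (by simpa using hj)) _ (by rw [h]; exact hY)
      have := congrArg card hS
      rw [List.toFinset_card_of_nodup hn] at this
      simpa using this
    · rw [pow_succ] at *; omega
  simp [topCoeff, key]

/-- The sign by which the reversal of `D` vectors changes their exterior product. -/
def revSign (D : ℕ) : ℤ := ∏ t : Fin D, ∏ _t' ∈ Ioi t, (-1 : ℤ)

theorem revSign_ne_zero (D : ℕ) : revSign D ≠ 0 :=
  prod_ne_zero_iff.2 fun _ _ => prod_ne_zero_iff.2 fun _ _ => by norm_num

/-- The multilinear expansion turns into the Leibniz formula. The extra factor `revSign D` arises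
because the basis is ordered decreasingly. -/
theorem topCoeff_rowVec {D : ℕ} (y : Fin D → ℕ → ℕ) :
    topCoeff D (rowVec D (List.ofFn y)) =
      revSign D * (Matrix.of fun t i : Fin D => (y t i : ℤ)).det := by
  have hpos : 0 < 2 ^ D := by positivity
  have hlt : 2 ^ D - 1 < 2 ^ (D + 1) := by rw [pow_succ]; omega
  have hlt' : 2 ^ (D + 1) - 1 < 2 ^ (D + 1) := by rw [pow_succ]; omega
  rw [topCoeff, rowVec_eq y hlt, rowVec_eq y hlt', ← Matrix.det_transpose, Matrix.det_apply',
    mul_sum]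
  push_cast
  rw [← sum_sub_distrib]
  symm
  have hl : ∀ p : Fin D → Fin D, ∀ i ∈ List.ofFn (fun t => (p t : ℕ)), i < D := by
    intro p i hi; obtain ⟨t, rfl⟩ := (List.mem_ofFn' _ _).1 hi; exact (p t).2
  -- Choices `p` that are not permutations repeat a basis vector; they lead to the zero code and
  -- contribute to neither top coefficient.
  refine Fintype.sum_of_injective (fun σ : Equiv.Perm (Fin D) => (σ : Fin D → Fin D))
    DFunLike.coe_injective _ _ ?_ ?_
  · intro p hp
    have hn : ¬ (List.ofFn (fun t => (p t : ℕ))).Nodup := by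
      rw [List.nodup_ofFn]
      intro h
      have hinj : Function.Injective p := fun a b hab => h (by simp [hab])
      exact hp ⟨Equiv.ofBijective p (Finite.injective_iff_bijective.1 hinj), rfl⟩
    rw [walk_eq _ (hl p), if_neg hn, if_neg (by omega), if_neg (by omega), sub_zero]
  · intro σ
    have hn : (List.ofFn (fun t => (σ t : ℕ))).Nodup := by
      rw [List.nodup_ofFn]
      exact Fin.val_injective.comp σ.injective
    have hS : (List.ofFn (fun t => (σ t : ℕ))).toFinset = range D := by
      apply eq_of_subset_of_card_le
      · intro i hi; exact mem_range.2 (hl σ i (by simpa using hi))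
      · rw [List.toFinset_card_of_nodup hn]; simp
    have hsgn := neg_one_pow_invCount (fun t => (σ t : ℕ))
    -- The sign of `σ` counts the decreasing pairs and `invCount` the increasing ones; together
    -- these are all pairs, whose sign is `revSign D`.
    have hs2 : (-1 : ℤ) ^ invCount (List.ofFn fun t => (σ t : ℕ)) =
        revSign D * (Equiv.Perm.sign σ : ℤ) := by
      rw [hsgn, σ.sign_eq_prod_prod_Ioi, revSign]
      push_cast
      rw [← prod_mul_distrib]
      refine prod_congr rfl fun t _ => ?_
      rw [← prod_mul_distrib]
      refine prod_congr rfl fun t' _ => ?_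
      simp only [Fin.val_fin_lt]
      split_ifs <;> simp
    rw [walk_eq _ (hl σ), if_pos hn, hS, code_range, ← mul_assoc, ← hs2]
    generalize invCount (List.ofFn fun t => (σ t : ℕ)) = v
    simp only [Matrix.transpose_apply, Matrix.of_apply]
    rcases Nat.mod_two_eq_zero_or_one v with h0 | h0
    · have hv : (-1 : ℤ) ^ v = 1 := Even.neg_one_pow (Nat.even_iff.2 h0)
      rw [h0, hv, if_pos (by simp), if_neg (by rw [pow_succ]; omega)]; simp
    · have hv : (-1 : ℤ) ^ v = -1 := Odd.neg_one_pow (Nat.odd_iff.2 h0)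
      rw [h0, hv, if_neg (by omega), if_pos (by rw [pow_succ]; omega)]; simp


/-! ### Doubled moment vectors and squares of Vandermonde determinants -/

/-- Exterior multiplication by one of the two copies of the moment vector of `v`. -/
def wedge (K v side : ℕ) (f : ℕ → ℕ) (Y : ℕ) : ℕ :=
  ∑ j ∈ range K, v ^ j * push (K * 2) (2 * j + side) f Y

/-- Exterior multiplication by both copies of the moment vector of `v`. -/
def wedgeVertex (K v : ℕ) (f : ℕ → ℕ) : ℕ → ℕ := wedge K v 0 (wedge K v 1 f)

/-- The coefficient vector of a list of vertices. -/
def vertexVec (K : ℕ) : List ℕ → ℕ → ℕ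
  | [] => fun Y => if Y = 0 then 1 else 0
  | v :: l => wedgeVertex K v (vertexVec K l)

/-- The two copies of the moment vector of `v`. -/
def momentRow (v side i : ℕ) : ℕ := if i % 2 = side then v ^ (i / 2) else 0

theorem wedge_eq {K v side : ℕ} (hs : side < 2) (f : ℕ → ℕ) (Y : ℕ) :
    wedge K v side f Y = ∑ i ∈ range (K * 2), momentRow v side i * push (K * 2) i f Y := by
  rw [wedge]
  suffices h : ∀ D, ∑ j ∈ range K, v ^ j * push D (2 * j + side) f Y =
      ∑ i ∈ range (K * 2), momentRow v side i * push D i f Y from h _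
  intro D
  induction K with
  | zero => simp
  | succ K ih =>
    rw [sum_range_succ, ih, show (K + 1) * 2 = K * 2 + 1 + 1 by ring, sum_range_succ, sum_range_succ, add_assoc]
    congr 1
    have e1 : (K * 2) % 2 = 0 := by omega
    have e2 : (K * 2 + 1) % 2 = 1 := by omega
    have e3 : (K * 2) / 2 = K := by omega
    have e4 : (K * 2 + 1) / 2 = K := by omega
    rw [momentRow, momentRow, e1, e2, e3, e4, mul_comm 2 K]
    interval_cases side <;> simp

theorem vertexVec_eq (K : ℕ) (l : List ℕ) :
    vertexVec K l = rowVec (K * 2) (l.flatMap fun v => [momentRow v 0, momentRow v 1]) := by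
  induction l with
  | nil => rfl
  | cons v l ih =>
    funext Y
    simp only [vertexVec, wedgeVertex, List.flatMap_cons, List.cons_append, List.nil_append, rowVec]
    rw [wedge_eq (by norm_num)]
    refine sum_congr rfl fun i _ => ?_
    congr 2
    funext Y
    rw [wedge_eq (by norm_num), ih]

/-- Rows and columns are indexed by pairs of a position and a copy. An entry vanishes unless the
copies agree, so the matrix is block diagonal with two equal Vandermonde blocks. Reindexing both
sides by the same bijection leaves the determinant unchanged. -/
theorem det_momentRow {K : ℕ} (x : Fin K → ℕ) :
    (Matrix.of fun t i : Fin (K * 2) => (momentRow (x t.divNat) t.modNat i : ℤ)).det =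
      (Matrix.vandermonde fun a => (x a : ℤ)).det ^ 2 := by
  rw [← Matrix.det_submatrix_equiv_self (finProdFinEquiv (m := K) (n := 2))]
  have : (Matrix.of fun t i : Fin (K * 2) =>
      (momentRow (x t.divNat) t.modNat i : ℤ)).submatrix finProdFinEquiv finProdFinEquiv =
      Matrix.blockDiagonal fun _ : Fin 2 => Matrix.vandermonde fun a => (x a : ℤ) := by
    ext ⟨a, s⟩ ⟨b, s'⟩
    have h1 : (finProdFinEquiv (a, s)).divNat = a :=
      congrArg Prod.fst (finProdFinEquiv.symm_apply_apply (a, s))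
    have h2 : (finProdFinEquiv (a, s)).modNat = s :=
      congrArg Prod.snd (finProdFinEquiv.symm_apply_apply (a, s))
    have h3 : ((finProdFinEquiv (b, s') : Fin (K * 2)) : ℕ) = s' + 2 * b := rfl
    have h4 : (s' + 2 * b : ℕ) % 2 = s' := by omega
    have h5 : (s' + 2 * b : ℕ) / 2 = b := by omega
    rw [Matrix.submatrix_apply, Matrix.of_apply, h1, h2, h3, momentRow, h4, h5,
      Matrix.blockDiagonal_apply]
    by_cases h : s = s'
    · simp [h, Matrix.vandermonde]
    · have : (s' : ℕ) ≠ s := fun h' => h (Fin.ext h'.symm)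
      simp [h, this]
  rw [this, Matrix.det_blockDiagonal]
  simp

theorem topCoeff_vertexVec {K : ℕ} (x : Fin K → ℕ) :
    topCoeff (K * 2) (vertexVec K (List.ofFn x)) =
      revSign (K * 2) * (Matrix.vandermonde fun a => (x a : ℤ)).det ^ 2 := by
  have : ((List.ofFn x).flatMap fun v => [momentRow v 0, momentRow v 1]) =
      List.ofFn fun t : Fin (K * 2) => momentRow (x t.divNat) t.modNat := by
    rw [List.ofFn_mul, List.flatMap, List.map_ofFn]
    congr 2
    funext a
    rw [List.ofFn_succ, List.ofFn_succ]
    simp only [List.ofFn_zero, Function.comp]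
    have h : ∀ s : Fin 2, ∀ h, (⟨a * 2 + s, h⟩ : Fin (K * 2)) = finProdFinEquiv (a, s) := by
      intro s h; apply Fin.ext; simp only [finProdFinEquiv_apply_val]; ring
    simp only [h]
    have h1 : ∀ s, (finProdFinEquiv (a, s) : Fin (K * 2)).divNat = a := fun s =>
      congrArg Prod.fst (finProdFinEquiv.symm_apply_apply (a, s))
    have h2 : ∀ s, (finProdFinEquiv (a, s) : Fin (K * 2)).modNat = s := fun s =>
      congrArg Prod.snd (finProdFinEquiv.symm_apply_apply (a, s))
    simp [h1, h2]
  rw [vertexVec_eq, this, topCoeff_rowVec, det_momentRow]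

/-- Up to the common sign, `g` is the squared Vandermonde determinant if `l` has length `K`, and `0`
otherwise. Its being nonnegative is the reason for doubling the moment vectors. -/
theorem exists_topCoeff_vertexVec (K : ℕ) (l : List ℕ) :
    ∃ g : ℤ, 0 ≤ g ∧ topCoeff (K * 2) (vertexVec K l) = revSign (K * 2) * g ∧
      (g ≠ 0 ↔ l.length = K ∧ l.Nodup) := by
  by_cases hl : l.length = K
  · subst hl
    refine ⟨(Matrix.vandermonde fun a => (l.get a : ℤ)).det ^ 2, sq_nonneg _, ?_, ?_⟩
    · have := topCoeff_vertexVec l.get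
      rwa [List.ofFn_get] at this
    · rw [pow_ne_zero_iff two_ne_zero, Matrix.det_vandermonde_ne_zero_iff]
      simp only [true_and, List.nodup_iff_injective_get]
      exact ⟨fun h a b hab => h (congrArg (Nat.cast : ℕ → ℤ) hab), fun h a b hab => h (by simpa using hab)⟩
  · refine ⟨0, le_rfl, ?_, by simp [hl]⟩
    rw [vertexVec_eq, ← List.ofFn_get (l.flatMap _), topCoeff_rowVec_eq_zero, mul_zero]
    simp only [List.length_flatMap, List.length_cons, List.length_nil, List.map_const',
      List.sum_replicate, smul_eq_mul]
    omega

/-! ### Words of edges, grouped by colour -/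

/-- The list of endpoints of a list of edges. -/
def endpoints (eu ev : ℕ → ℕ) (w : List ℕ) : List ℕ := w.flatMap fun e => [eu e, ev e]

/-- The sum of the coefficient vectors of a list of words of edges. -/
def wordSum (eu ev : ℕ → ℕ) (K : ℕ) (ws : List (List ℕ)) (X : ℕ) : ℕ :=
  (ws.map fun w => vertexVec K (endpoints eu ev w) X).sum

/-- All summands share the factor `revSign (K * 2)`, and their cofactors are nonnegative, so the sum
vanishes only if every summand does. -/
theorem topCoeff_wordSum_ne_zero_iff {eu ev : ℕ → ℕ} {K : ℕ} {ws : List (List ℕ)} :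
    topCoeff (K * 2) (wordSum eu ev K ws) ≠ 0 ↔
      ∃ w ∈ ws, (endpoints eu ev w).length = K ∧ (endpoints eu ev w).Nodup := by
  choose g h0 h1 h2 using exists_topCoeff_vertexVec K
  have : topCoeff (K * 2) (wordSum eu ev K ws) =
      revSign (K * 2) * (ws.map fun w => g (endpoints eu ev w)).sum := by
    induction ws with
    | nil => simp [wordSum, topCoeff]
    | cons w ws ih =>
      rw [List.map_cons, List.sum_cons, mul_add, ← ih, ← h1]
      simp only [topCoeff, wordSum, List.map_cons, List.sum_cons]
      push_cast; ring
  rw [this, mul_ne_zero_iff_left (revSign_ne_zero _)]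
  simp only [← h2]
  constructor
  · intro h
    by_contra! hc
    exact h (List.sum_eq_zero (by simpa using hc))
  · rintro ⟨w, hw, hg⟩ h
    apply hg
    have := List.single_le_sum (l := ws.map fun w => g (endpoints eu ev w))
      (by simpa using fun w _ => h0 _) _ (List.mem_map.2 ⟨w, hw, rfl⟩)
    exact le_antisymm (h ▸ this) (h0 _)

/-- The words that arise by adding one edge of colour `c`. -/
def extend (m : ℕ) (ec : ℕ → ℕ) (c : ℕ) (ws : List (List ℕ)) : List (List ℕ) :=
  (List.range m).flatMap fun e => if ec e = c then ws.map (e :: ·) else []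

/-- The words that arise by adding an admissible number of edges of colour `c`. -/
def colourStep (m k : ℕ) (ok : ℕ → Prop) [DecidablePred ok] (ec : ℕ → ℕ) (c : ℕ)
    (ws : List (List ℕ)) : List (List ℕ) :=
  (List.range (k + 1)).flatMap fun i => if ok i then (extend m ec c)^[i] ws else []

/-- The words that arise after the colours `cl 0, …, cl (q - 1)` have been treated. -/
def words (m k : ℕ) (ok : ℕ → Prop) [DecidablePred ok] (ec cl : ℕ → ℕ) : ℕ → List (List ℕ)
  | 0 => [[]]
  | q + 1 => colourStep m k ok ec (cl q) (words m k ok ec cl q)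

theorem mem_extend {m : ℕ} {ec : ℕ → ℕ} {c : ℕ} {ws : List (List ℕ)} {w : List ℕ} :
    w ∈ extend m ec c ws ↔ ∃ e < m, ec e = c ∧ ∃ w' ∈ ws, w = e :: w' := by
  simp only [extend, List.mem_flatMap, List.mem_range]
  refine exists_congr fun e => and_congr_right fun _ => ?_
  split_ifs with h <;> simp [h, eq_comm]

theorem mem_extend_iterate {m : ℕ} {ec : ℕ → ℕ} {c : ℕ} {ws : List (List ℕ)} {w : List ℕ} {i : ℕ} :
    w ∈ (extend m ec c)^[i] ws ↔
      ∃ u : List ℕ, u.length = i ∧ (∀ e ∈ u, e < m ∧ ec e = c) ∧ ∃ w' ∈ ws, w = u ++ w' := by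
  induction i generalizing w with
  | zero => simp
  | succ i ih =>
    rw [Function.iterate_succ_apply', mem_extend]
    constructor
    · rintro ⟨e, he, hc, w1, hw1, rfl⟩
      obtain ⟨u, hu, h, w', hw', rfl⟩ := ih.1 hw1
      exact ⟨e :: u, by simp [hu], by simpa [he, hc] using h, w', hw', rfl⟩
    · rintro ⟨u, hu, h, w', hw', rfl⟩
      cases u with
      | nil => simp at hu
      | cons e u =>
        simp only [List.mem_cons, forall_eq_or_imp] at h
        exact ⟨e, h.1.1, h.1.2, u ++ w', ih.2 ⟨u, by simpa using hu, h.2, w', hw', rfl⟩, rfl⟩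

theorem mem_colourStep {m k : ℕ} {ok : ℕ → Prop} [DecidablePred ok] {ec : ℕ → ℕ} {c : ℕ}
    {ws : List (List ℕ)} {w : List ℕ} :
    w ∈ colourStep m k ok ec c ws ↔ ∃ u : List ℕ, u.length ≤ k ∧ ok u.length ∧
      (∀ e ∈ u, e < m ∧ ec e = c) ∧ ∃ w' ∈ ws, w = u ++ w' := by
  simp only [colourStep, List.mem_flatMap, List.mem_range]
  constructor
  · rintro ⟨i, hi, h⟩
    split_ifs at h with hok
    · obtain ⟨u, rfl, hu⟩ := mem_extend_iterate.1 h
      exact ⟨u, by omega, hok, hu⟩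
    · simp at h
  · rintro ⟨u, hk, hok, hu⟩
    refine ⟨u.length, by omega, ?_⟩
    rw [if_pos hok]
    exact mem_extend_iterate.2 ⟨u, rfl, hu⟩

/-- `w` lists the edges of a solution. -/
def IsSolutionWord (m k r : ℕ) (ok : ℕ → Prop) (eu ev ec cl : ℕ → ℕ) (w : List ℕ) : Prop :=
  w.length = k ∧ (∀ e ∈ w, e < m ∧ ∃ q < r, ec e = cl q) ∧ (endpoints eu ev w).Nodup ∧
    ∀ q < r, ok (w.countP fun e => ec e = cl q)

/-- A word is a concatenation of one block per colour. As the listed colours are distinct, the count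
of a colour is the length of its block, which was chosen to be `ok`. -/
theorem of_mem_words {m k : ℕ} {ok : ℕ → Prop} [DecidablePred ok] {ec cl : ℕ → ℕ} {r : ℕ}
    (hcl : ∀ q < r, ∀ q' < r, cl q = cl q' → q = q') {w : List ℕ}
    (hw : w ∈ words m k ok ec cl r) :
    (∀ e ∈ w, e < m ∧ ∃ q < r, ec e = cl q) ∧ ∀ q < r, ok (w.countP fun e => ec e = cl q) := by
  induction r generalizing w with
  | zero => simp_all [words]
  | succ r ih =>
    obtain ⟨u, -, hok, hu, w', hw', rfl⟩ := mem_colourStep.1 hw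
    obtain ⟨h1, h2⟩ := ih (fun q hq q' hq' => hcl q (by omega) q' (by omega)) hw'
    constructor
    · intro e he
      rcases List.mem_append.1 he with he | he
      · exact ⟨(hu e he).1, r, by omega, (hu e he).2⟩
      · obtain ⟨h, q, hq, hqe⟩ := h1 e he
        exact ⟨h, q, by omega, hqe⟩
    · intro q hq
      rw [List.countP_append]
      by_cases hqr : q = r
      · subst hqr
        have e1 : u.countP (fun e => ec e = cl q) = u.length :=
          List.countP_eq_length.2 fun e he => by simpa using (hu e he).2
        have e2 : w'.countP (fun e => ec e = cl q) = 0 := by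
          rw [List.countP_eq_zero]
          intro e he
          obtain ⟨-, q', hq', hqe⟩ := h1 e he
          simp only [decide_eq_true_eq]
          intro h
          have := hcl q' (by omega) q (by omega) (hqe.symm.trans h)
          omega
        rwa [e1, e2]
      · have e1 : u.countP (fun e => ec e = cl q) = 0 := by
          rw [List.countP_eq_zero]
          intro e he
          simp only [decide_eq_true_eq]
          intro h
          exact hqr (hcl q hq r (by omega) (h.symm.trans (hu e he).2))
        rw [e1, zero_add]
        exact h2 q (by omega)

/-- Sort the word by colour: the edges of the last colour form the front block and the rest is
handled by induction. The order of edges is irrelevant for solutions, so one representative is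
enough. -/
theorem exists_perm_mem_words {m k : ℕ} {ok : ℕ → Prop} [DecidablePred ok] {ec cl : ℕ → ℕ} {r : ℕ}
    (hcl : ∀ q < r, ∀ q' < r, cl q = cl q' → q = q') {w : List ℕ} (hk : w.length ≤ k)
    (h1 : ∀ e ∈ w, e < m ∧ ∃ q < r, ec e = cl q)
    (h2 : ∀ q < r, ok (w.countP fun e => ec e = cl q)) :
    ∃ w' ∈ words m k ok ec cl r, w'.Perm w := by
  induction r generalizing w with
  | zero =>
    cases w with
    | nil => exact ⟨[], by simp [words]⟩
    | cons e w => simpa using (h1 e (by simp)).2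
  | succ r ih =>
    have hperm := List.filter_append_perm (fun e => decide (ec e = cl r)) w
    obtain ⟨w', hw', hp⟩ := ih (w := w.filter (fun e => !decide (ec e = cl r)))
      (fun q hq q' hq' => hcl q (by omega) q' (by omega))
      ((List.length_filter_le _ _).trans hk)
      (by
        intro e he
        simp only [List.mem_filter, Bool.not_eq_eq_eq_not, Bool.not_true,
          decide_eq_false_iff_not] at he
        obtain ⟨h, q, hq, hqe⟩ := h1 e he.1
        have : q ≠ r := fun h => he.2 (h ▸ hqe)
        exact ⟨h, q, by omega, hqe⟩)
      (by
        intro q hq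
        have := h2 q (by omega)
        rw [List.countP_filter]
        convert! this using 2
        funext e
        have : ec e = cl q → ec e ≠ cl r := fun h h' => by
          have := hcl q (by omega) r (by omega) (h.symm.trans h')
          omega
        simp only [← decide_not, Bool.and_eq_left_iff_imp,
          decide_eq_true_eq]
        exact this)
    refine ⟨w.filter (fun e => decide (ec e = cl r)) ++ w', mem_colourStep.2
      ⟨_, (List.length_filter_le _ _).trans hk, ?_, ?_, w', hw', rfl⟩, ?_⟩
    · rw [← List.countP_eq_length_filter]
      exact h2 r (by omega)
    · intro e he
      simp only [List.mem_filter, decide_eq_true_eq] at he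
      exact ⟨(h1 e he.1).1, he.2⟩
    · exact (hp.append_left _).trans hperm

theorem length_endpoints (eu ev : ℕ → ℕ) (w : List ℕ) :
    (endpoints eu ev w).length = w.length * 2 := by
  simp [endpoints, List.length_flatMap]

/-- The words need not have length `k`, but only those with `2 * k` endpoints reach the top degree.
-/
theorem topCoeff_words_ne_zero_iff {m k r : ℕ} {ok : ℕ → Prop} [DecidablePred ok]
    {eu ev ec cl : ℕ → ℕ} (hcl : ∀ q < r, ∀ q' < r, cl q = cl q' → q = q') :
    topCoeff (k * 2 * 2) (wordSum eu ev (k * 2) (words m k ok ec cl r)) ≠ 0 ↔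
      ∃ w, IsSolutionWord m k r ok eu ev ec cl w := by
  rw [topCoeff_wordSum_ne_zero_iff]
  constructor
  · rintro ⟨w, hw, hl, hn⟩
    obtain ⟨h1, h2⟩ := of_mem_words hcl hw
    rw [length_endpoints] at hl
    exact ⟨w, by omega, h1, hn, h2⟩
  · rintro ⟨w, hl, h1, hn, h2⟩
    obtain ⟨w', hw', hp⟩ := exists_perm_mem_words hcl hl.le h1 h2
    refine ⟨w', hw', ?_, ?_⟩
    · rw [length_endpoints, hp.length_eq, hl]
    · exact (hp.flatMap_right _).nodup_iff.2 hn


/-! ### A program logic with time bounds and frames -/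

@[simp] theorem State.setReg_reg_self (s : State) (r v : ℕ) : (s.setReg r v).reg r = v := by
  simp [State.setReg]

theorem State.setReg_reg_of_ne (s : State) {r r' : ℕ} (v : ℕ) (h : r' ≠ r) :
    (s.setReg r v).reg r' = s.reg r' := by
  simp [State.setReg, h]

theorem State.setReg_reg (s : State) (r v r' : ℕ) :
    (s.setReg r v).reg r' = if r' = r then v else s.reg r' := by
  simp [State.setReg, Function.update_apply]

@[simp] theorem State.setReg_mem (s : State) (r v : ℕ) : (s.setReg r v).mem = s.mem := rfl

@[simp] theorem State.setMem_reg (s : State) (a i v : ℕ) : (s.setMem a i v).reg = s.reg := rfl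

@[simp] theorem State.setMem_mem_self (s : State) (a i v : ℕ) :
    (s.setMem a i v).mem a = Function.update (s.mem a) i v := by
  simp [State.setMem]

theorem State.setMem_mem (s : State) (a i v a' : ℕ) :
    (s.setMem a i v).mem a' = if a' = a then Function.update (s.mem a) i v else s.mem a' := by
  by_cases h : a' = a
  · subst h; simp
  · simp [State.setMem, h]

/-- `p` may write register `x`. -/
def Prog.writes : Prog → ℕ → Bool
  | .const r _, x => x == r
  | .add r _ _, x => x == r
  | .sub r _ _, x => x == r
  | .load r _ _, x => x == r
  | .store _ _ _, _ => false
  | .seq p q, x => p.writes x || q.writes x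
  | .ifLt _ _ p q, x => p.writes x || q.writes x
  | .whileLt _ _ p, x => p.writes x

/-- `p` may write to array `x`. -/
def Prog.stores : Prog → ℕ → Bool
  | .const _ _, _ => false
  | .add _ _ _, _ => false
  | .sub _ _ _, _ => false
  | .load _ _ _, _ => false
  | .store a _ _, x => x == a
  | .seq p q, x => p.stores x || q.stores x
  | .ifLt _ _ p q, x => p.stores x || q.stores x
  | .whileLt _ _ p, x => p.stores x

/-- `s` and `s'` agree wherever `p` does not write. -/
structure Frame (p : Prog) (s s' : State) : Prop where
  reg : ∀ r, p.writes r = false → s'.reg r = s.reg r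
  mem : ∀ a, p.stores a = false → s'.mem a = s.mem a

/-- Since `writes` and `stores` are computed from the program text, the side condition that a
register or array is untouched is settled by `rfl` for every concrete program. -/
theorem Exec.frame {p : Prog} {s s' : State} {t : ℕ} (h : Exec p s t s') : Frame p s s' := by
  induction h with
  | const s r v =>
    exact ⟨fun x hx => State.setReg_reg_of_ne _ _ (by simpa [Prog.writes] using hx), fun _ _ => rfl⟩
  | add s r i j =>
    exact ⟨fun x hx => State.setReg_reg_of_ne _ _ (by simpa [Prog.writes] using hx), fun _ _ => rfl⟩
  | sub s r i j =>
    exact ⟨fun x hx => State.setReg_reg_of_ne _ _ (by simpa [Prog.writes] using hx), fun _ _ => rfl⟩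
  | load s r a i =>
    exact ⟨fun x hx => State.setReg_reg_of_ne _ _ (by simpa [Prog.writes] using hx), fun _ _ => rfl⟩
  | store s a i j =>
    refine ⟨fun x hx => rfl, fun x hx => ?_⟩
    rw [State.setMem_mem, if_neg (by simpa [Prog.stores] using hx)]
  | seq _ _ ih1 ih2 =>
    refine ⟨fun x hx => ?_, fun x hx => ?_⟩
    · simp only [Prog.writes, Bool.or_eq_false_iff] at hx
      rw [ih2.reg x hx.2, ih1.reg x hx.1]
    · simp only [Prog.stores, Bool.or_eq_false_iff] at hx
      rw [ih2.mem x hx.2, ih1.mem x hx.1]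
  | ifLt_true _ _ ih =>
    refine ⟨fun x hx => ?_, fun x hx => ?_⟩
    · simp only [Prog.writes, Bool.or_eq_false_iff] at hx
      exact ih.reg x hx.1
    · simp only [Prog.stores, Bool.or_eq_false_iff] at hx
      exact ih.mem x hx.1
  | ifLt_false _ _ ih =>
    refine ⟨fun x hx => ?_, fun x hx => ?_⟩
    · simp only [Prog.writes, Bool.or_eq_false_iff] at hx
      exact ih.reg x hx.2
    · simp only [Prog.stores, Bool.or_eq_false_iff] at hx
      exact ih.mem x hx.2
  | whileLt_true _ _ _ ih1 ih2 =>
    refine ⟨fun x hx => ?_, fun x hx => ?_⟩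
    · rw [ih2.reg x hx, ih1.reg x (by simpa only [Prog.writes] using hx)]
    · rw [ih2.mem x hx, ih1.mem x (by simpa only [Prog.stores] using hx)]
  | whileLt_false _ => exact ⟨fun _ _ => rfl, fun _ _ => rfl⟩

/-- Started in `s`, the program `p` halts within `T` steps in a state that satisfies `Q`. -/
def Runs (p : Prog) (s : State) (T : ℕ) (Q : State → Prop) : Prop :=
  ∃ t s', Exec p s t s' ∧ t ≤ T ∧ Q s'

section Rules

variable {p q : Prog} {s : State} {T T' T₁ T₂ : ℕ} {Q Q' : State → Prop} {r v i j a : ℕ}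

theorem Runs.mono (h : Runs p s T Q) (hT : T ≤ T') (hQ : ∀ s', Q s' → Frame p s s' → Q' s') :
    Runs p s T' Q' :=
  let ⟨t, s', he, ht, hs⟩ := h
  ⟨t, s', he, ht.trans hT, hQ s' hs he.frame⟩

theorem Runs.const (h : Q (s.setReg r v)) : Runs (.const r v) s 1 Q :=
  ⟨_, _, Exec.const .., le_rfl, h⟩

theorem Runs.add (h : Q (s.setReg r (s.reg i + s.reg j))) : Runs (.add r i j) s 1 Q :=
  ⟨_, _, Exec.add .., le_rfl, h⟩

theorem Runs.sub (h : Q (s.setReg r (s.reg i - s.reg j))) : Runs (.sub r i j) s 1 Q :=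
  ⟨_, _, Exec.sub .., le_rfl, h⟩

theorem Runs.load (h : Q (s.setReg r (s.mem a (s.reg i)))) : Runs (.load r a i) s 1 Q :=
  ⟨_, _, Exec.load .., le_rfl, h⟩

theorem Runs.store (h : Q (s.setMem a (s.reg i) (s.reg j))) : Runs (.store a i j) s 1 Q :=
  ⟨_, _, Exec.store .., le_rfl, h⟩

theorem Runs.seq (h : Runs p s T₁ fun s' => Runs q s' T₂ Q) : Runs (.seq p q) s (T₁ + T₂) Q :=
  let ⟨_, _, he, ht, _, s'', he', ht', hs⟩ := h
  ⟨_, s'', he.seq he', add_le_add ht ht', hs⟩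

/-- Sequential composition, with the frame of the first part made available to the second. -/
theorem Runs.seq_of (h : Runs p s T₁ Q') (h' : ∀ s', Q' s' → Frame p s s' → Runs q s' T₂ Q) :
    Runs (.seq p q) s (T₁ + T₂) Q :=
  Runs.seq (h.mono le_rfl h')

theorem Runs.ifLt (h : s.reg i < s.reg j → Runs p s T Q) (h' : ¬ s.reg i < s.reg j → Runs q s T Q) :
    Runs (.ifLt i j p q) s (T + 1) Q := by
  by_cases hc : s.reg i < s.reg j
  · obtain ⟨t, s', he, ht, hs⟩ := h hc
    exact ⟨_, s', he.ifLt_true hc, by omega, hs⟩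
  · obtain ⟨t, s', he, ht, hs⟩ := h' hc
    exact ⟨_, s', he.ifLt_false hc, by omega, hs⟩

end Rules

/-- `for i = 0, …, n - 1 do p`, where `i`, `n` are registers and register `1` holds `1`. -/
def Prog.forLt (i n : ℕ) (p : Prog) : Prog :=
  .seq (.const i 0) (.whileLt i n (.seq p (.add i i 1)))

/-- Every round costs the body, one addition and one test; initialisation and the final failing test
account for the `+ 2`. The body may use that everything the loop does not write still has its value
from `s`. -/
theorem Runs.forLt {i n : ℕ} {p : Prog} {s : State} {N T : ℕ} (Inv : ℕ → State → Prop)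
    (hN : s.reg n = N) (h1 : s.reg 1 = 1)
    (hw : p.writes i = false ∧ p.writes n = false ∧ p.writes 1 = false ∧ n ≠ i ∧ 1 ≠ i)
    (h0 : Inv 0 (s.setReg i 0))
    (hp : ∀ m s', m < N → Inv m s' → Frame (.forLt i n p) s s' → s'.reg i = m →
      Runs p s' T fun s'' => Inv (m + 1) (s''.setReg i (m + 1))) :
    Runs (.forLt i n p) s (N * (T + 2) + 2) (Inv N) := by
  obtain ⟨hwi, hwn, hw1, hni, h1i⟩ := hw
  -- Induction on the number `d` of rounds that remain.
  have key : ∀ d m s', m + d = N → Inv m s' → Frame (.forLt i n p) s s' → s'.reg i = m →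
      Runs (.whileLt i n (.seq p (.add i i 1))) s' (d * (T + 2) + 1) (Inv N) := by
    intro d
    induction d with
    | zero =>
      intro m s' hm hI hF hi
      have hn : s'.reg n = N := by
        rw [hF.reg n (by simp [Prog.forLt, Prog.writes, hwn, hni]), hN]
      refine ⟨_, _, Exec.whileLt_false (by omega), by omega, ?_⟩
      rwa [← hm]
    | succ d ih =>
      intro m s' hm hI hF hi
      have hn : s'.reg n = N := by
        rw [hF.reg n (by simp [Prog.forLt, Prog.writes, hwn, hni]), hN]
      have h1' : s'.reg 1 = 1 := by
        rw [hF.reg 1 (by simp [Prog.forLt, Prog.writes, hw1, h1i]), h1]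
      obtain ⟨t, s'', he, ht, hI'⟩ := hp m s' (by omega) hI hF hi
      have hadd := Exec.add s'' i i 1
      have e1 : s''.reg i = m := by rw [he.frame.reg i hwi, hi]
      have e2 : s''.reg 1 = 1 := by rw [he.frame.reg 1 hw1, h1']
      rw [e1, e2] at hadd
      have hF' : Frame (.forLt i n p) s (s''.setReg i (m + 1)) := by
        constructor
        · intro r hr
          have hr' := hr
          simp only [Prog.forLt, Prog.writes, Bool.or_eq_false_iff, beq_eq_false_iff_ne] at hr
          rw [State.setReg_reg_of_ne _ _ hr.1, he.frame.reg r hr.2.1, hF.reg r hr']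
        · intro a ha
          have ha' := ha
          simp only [Prog.forLt, Prog.stores, Bool.or_eq_false_iff] at ha
          rw [State.setReg_mem, he.frame.mem a ha.2.1, hF.mem a ha']
      obtain ⟨t', s₃, he', ht', hI₃⟩ := ih (m + 1) _ (by omega) hI' hF' (by simp)
      refine ⟨_, s₃, Exec.whileLt_true (by omega) (he.seq hadd) he', ?_, hI₃⟩
      rw [Nat.succ_mul]; omega
  refine (Runs.seq (T₁ := 1) (T₂ := N * (T + 2) + 1) (Runs.const ?_)).mono (by omega)
    fun s' h _ => h
  refine key N 0 _ (by omega) h0 ?_ (by simp)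
  refine ⟨fun r hr => ?_, fun _ _ => rfl⟩
  simp only [Prog.forLt, Prog.writes, Bool.or_eq_false_iff, beq_eq_false_iff_ne] at hr
  rw [State.setReg_reg_of_ne _ _ hr.1]

/-- The running time of a `for` loop in terms of a bound `B` for everything in sight. -/
theorem loop_time_le {B N T c e : ℕ} (hB : 1 ≤ B) (hN : N ≤ B) (hT : T ≤ c * B ^ e) :
    N * (T + 2) + 2 ≤ (c + 4) * B ^ (e + 1) := by
  have h1 : 1 ≤ B ^ e := Nat.one_le_pow _ _ hB
  have h2 : 1 ≤ B ^ (e + 1) := Nat.one_le_pow _ _ hB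
  calc N * (T + 2) + 2 ≤ B * (c * B ^ e + 2 * B ^ e) + 2 * B ^ (e + 1) := by
        gcongr <;> omega
    _ = (c + 4) * B ^ (e + 1) := by ring


theorem Runs.le {p : Prog} {s : State} {T T' : ℕ} {Q : State → Prop} (h : Runs p s T Q)
    (hT : T ≤ T') : Runs p s T' Q :=
  h.mono hT fun _ h _ => h

theorem Runs.seq1 {p q : Prog} {s : State} {T : ℕ} {Q : State → Prop}
    (h : Runs p s 1 fun s' => Runs q s' T Q) : Runs (.seq p q) s (T + 1) Q :=
  (Runs.seq h).mono (by omega) fun _ h _ => h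

/-- With every loop length bounded by the same `B`, each level of nesting raises the exponent by one
and the coefficient by four. -/
theorem Runs.forLt_pow {i n : ℕ} {p : Prog} {s : State} {N B c e : ℕ} (Inv : ℕ → State → Prop)
    (hN : s.reg n = N) (h1 : s.reg 1 = 1)
    (hw : p.writes i = false ∧ p.writes n = false ∧ p.writes 1 = false ∧ n ≠ i ∧ 1 ≠ i)
    (hB : 1 ≤ B) (hNB : N ≤ B)
    (h0 : Inv 0 (s.setReg i 0))
    (hp : ∀ m s', m < N → Inv m s' → Frame (.forLt i n p) s s' → s'.reg i = m →
      Runs p s' (c * B ^ e) fun s'' => Inv (m + 1) (s''.setReg i (m + 1))) :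
    Runs (.forLt i n p) s ((c + 4) * B ^ (e + 1)) (Inv N) :=
  (Runs.forLt Inv hN h1 hw h0 hp).mono (loop_time_le hB hNB le_rfl) fun _ h _ => h

/-! ### Programs for arithmetic in the exterior algebra -/

/-- The registers that stay constant during the decision procedure, and the table of powers. -/
structure Env (k : ℕ) (s : State) : Prop where
  one : s.reg 1 = 1
  zero : s.reg 2 = 0
  dim : s.reg 10 = k * 2 * 2
  half : s.reg 11 = 2 ^ (k * 2 * 2)
  size : s.reg 12 = 2 ^ (k * 2 * 2 + 1)
  top : s.reg 13 = 2 ^ (k * 2 * 2) - 1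
  top' : s.reg 14 = 2 ^ (k * 2 * 2 + 1) - 1
  verts : s.reg 17 = k * 2
  succ : s.reg 18 = k + 1
  pow : ∀ i ≤ k * 2 * 2, s.mem 7 i = 2 ^ i

/-- `p` writes neither to the registers below `20` nor to the table of powers. -/
def Prog.keepsEnv (p : Prog) : Bool :=
  (List.range 20).all (fun r => !p.writes r) && !p.stores 7

theorem Frame.reg_lt {p : Prog} {s s' : State} (hF : Frame p s s') (hp : p.keepsEnv = true)
    {r : ℕ} (hr : r < 20) : s'.reg r = s.reg r := by
  simp only [Prog.keepsEnv, Bool.and_eq_true, List.all_eq_true, List.mem_range,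
    Bool.not_eq_eq_eq_not, Bool.not_true] at hp
  exact hF.reg r (hp.1 r hr)

theorem Env.frame {k : ℕ} {s s' : State} {p : Prog} (h : Env k s) (hF : Frame p s s')
    (hp : p.keepsEnv = true) : Env k s' := by
  have hr : ∀ r < 20, s'.reg r = s.reg r := fun r => hF.reg_lt hp
  have hm : s'.mem 7 = s.mem 7 := hF.mem 7 (by
    simp only [Prog.keepsEnv, Bool.and_eq_true, Bool.not_eq_eq_eq_not, Bool.not_true] at hp
    exact hp.2)
  constructor
  · rw [hr 1 (by norm_num), h.one]
  · rw [hr 2 (by norm_num), h.zero]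
  · rw [hr 10 (by norm_num), h.dim]
  · rw [hr 11 (by norm_num), h.half]
  · rw [hr 12 (by norm_num), h.size]
  · rw [hr 13 (by norm_num), h.top]
  · rw [hr 14 (by norm_num), h.top']
  · rw [hr 17 (by norm_num), h.verts]
  · rw [hr 18 (by norm_num), h.succ]
  · rw [hm]; exact h.pow

theorem Env.setReg {k : ℕ} {s : State} (h : Env k s) {r : ℕ} (hr : 20 ≤ r) (v : ℕ) :
    Env k (s.setReg r v) := by
  have hs : ∀ r' < 20, (s.setReg r v).reg r' = s.reg r' :=
    fun r' hr' => State.setReg_reg_of_ne _ _ (by omega)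
  constructor
  · rw [hs 1 (by norm_num), h.one]
  · rw [hs 2 (by norm_num), h.zero]
  · rw [hs 10 (by norm_num), h.dim]
  · rw [hs 11 (by norm_num), h.half]
  · rw [hs 12 (by norm_num), h.size]
  · rw [hs 13 (by norm_num), h.top]
  · rw [hs 14 (by norm_num), h.top']
  · rw [hs 17 (by norm_num), h.verts]
  · rw [hs 18 (by norm_num), h.succ]
  · exact h.pow

namespace Prog

/-- Set the vector `a` to zero. -/
def vzero (a : ℕ) : Prog := .forLt 30 12 (.store a 30 2)

/-- Add the vector `b` to the vector `a`. -/
def vadd (a b : ℕ) : Prog :=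
  .forLt 30 12 (.seq (.load 31 a 30) (.seq (.load 32 b 30) (.seq (.add 31 31 32) (.store a 30 31))))

/-- Copy the vector `b` to `a`. -/
def vcopy (a b : ℕ) : Prog := .seq (vzero a) (vadd a b)

/-- Multiply the vector in array `11` by register `33`. -/
def scale : Prog := .seq (vzero 13) (.seq (.forLt 34 33 (vadd 13 11)) (vcopy 11 13))

/-- One step of the scan. -/
def scanStep : Prog :=
  .seq (.sub 44 40 42) (.seq (.load 41 7 44)
    (.ifLt 39 41 (.const 45 0) (.seq (.sub 39 39 41) (.sub 38 11 38))))

/-- Compute `nx` of registers `35` and `30` in register `36`. -/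
def nx : Prog :=
  .seq (.ifLt 30 11 (.seq (.add 37 30 2) (.const 38 0)) (.seq (.sub 37 30 11) (.add 38 11 2)))
  (.seq (.add 39 37 2) (.seq (.sub 40 10 1) (.seq (.sub 43 40 35)
  (.seq (.forLt 42 43 scanStep) (.seq (.load 41 7 35)
  (.ifLt 39 41 (.seq (.add 36 37 41) (.add 36 36 38)) (.seq (.add 36 12 2) (.const 45 0))))))))

/-- Add to the vector in array `12` the image of array `11` under the insertion of register `35`. -/
def push : Prog :=
  .forLt 30 12 (.seq nx
    (.seq (.load 44 11 30) (.seq (.load 45 12 36) (.seq (.add 44 44 45) (.store 12 36 44)))))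

/-- Apply `wedge` to the vector in array `11`, for the vertex in register `33`. -/
def wedge (side : ℕ) : Prog :=
  .seq (vzero 12) (.seq (.const 35 side)
  (.seq (.forLt 47 17 (.seq push (.seq (.add 35 35 1) (.seq (.add 35 35 1) scale))))
  (vcopy 11 12)))

/-- Apply `wedgeVertex` to the vector in array `11`, for the vertex in register `33`. -/
def wedgeVertex : Prog := .seq (wedge 1) (wedge 0)

end Prog

section

variable {s : State} {Z B k : ℕ}

theorem runs_vzero (a : ℕ) (h1 : s.reg 1 = 1) (h2 : s.reg 2 = 0) (hZ : s.reg 12 = Z)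
    (hB : 1 ≤ B) (hZB : Z ≤ B) :
    Runs (.vzero a) s (5 * B) fun s' => ∀ X < Z, s'.mem a X = 0 := by
  refine (Runs.forLt_pow (B := B) (c := 1) (e := 0) (fun m s' => ∀ X < m, s'.mem a X = 0) hZ h1
    ⟨rfl, rfl, rfl, by decide, by decide⟩ hB hZB (by simp) ?_).mono (by simp) fun _ h _ => h
  intro m s' _ hI hF hi
  refine Runs.store ?_
  intro X hX
  have e2 : s'.reg 2 = 0 := by rw [hF.reg 2 rfl, h2]
  rw [State.setReg_mem, State.setMem_mem_self, hi, e2]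
  by_cases h : X = m
  · simp [h]
  · rw [Function.update_of_ne h]; exact hI X (by omega)

theorem runs_vadd {a b : ℕ} (hab : b ≠ a) (h1 : s.reg 1 = 1) (hZ : s.reg 12 = Z)
    (hB : 1 ≤ B) (hZB : Z ≤ B) :
    Runs (.vadd a b) s (8 * B) fun s' => ∀ X < Z, s'.mem a X = s.mem a X + s.mem b X := by
  refine (Runs.forLt_pow (B := B) (c := 4) (e := 0) (fun m s' => ∀ X, s'.mem a X =
    if X < m then s.mem a X + s.mem b X else s.mem a X) hZ h1
    ⟨rfl, rfl, rfl, by decide, by decide⟩ hB hZB (by simp) ?_).mono (by simp)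
    fun s' h _ X hX => by rw [h, if_pos hX]
  intro m s' _ hI hF hi
  refine Runs.seq1 (Runs.load (Runs.seq1 (Runs.load (Runs.seq1 (Runs.add (Runs.store ?_))))))
  have e2 : s'.mem b = s.mem b :=
    hF.mem b (by simp [Prog.forLt, Prog.stores, hab])
  intro X
  simp only [State.setReg_mem, State.setMem_mem_self, State.setReg_reg, hi, e2]
  norm_num
  by_cases h : X = m
  · simp [h, hI]
  · rw [Function.update_of_ne (by simpa [hi] using h), hI]
    have : X < m ↔ X < m + 1 := by omega
    simp [this]

theorem runs_vcopy {a b : ℕ} (hab : b ≠ a) (h1 : s.reg 1 = 1) (h2 : s.reg 2 = 0)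
    (hZ : s.reg 12 = Z) (hB : 1 ≤ B) (hZB : Z ≤ B) :
    Runs (.vcopy a b) s (13 * B) fun s' => ∀ X < Z, s'.mem a X = s.mem b X := by
  refine (Runs.seq_of (runs_vzero a h1 h2 hZ hB hZB) fun s' h hF =>
    (runs_vadd (B := B) (Z := Z) hab ((hF.reg 1 rfl).trans h1) ((hF.reg 12 rfl).trans hZ)
      hB hZB).mono le_rfl ?_).le (by omega)
  intro s'' h' hF' X hX
  rw [h' X hX, h X hX, zero_add, hF.mem b (by simp [Prog.vzero, Prog.forLt, Prog.stores, hab])]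

/-- The machine cannot multiply, so the vector is added `v` times; this is affordable because `v` is
a vertex number and at most `B`. -/
theorem runs_scale {v : ℕ} (h1 : s.reg 1 = 1) (h2 : s.reg 2 = 0) (hZ : s.reg 12 = Z)
    (hv : s.reg 33 = v) (hB : 1 ≤ B) (hZB : Z ≤ B) (hvB : v ≤ B) :
    Runs .scale s (30 * B ^ 2) fun s' => ∀ X < Z, s'.mem 11 X = v * s.mem 11 X := by
  refine (Runs.seq_of (runs_vzero 13 h1 h2 hZ hB hZB) fun s1 hs1 hF1 => Runs.seq_of
    (Runs.forLt_pow (B := B) (c := 8) (e := 1) (N := v)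
      (fun m s' => ∀ X < Z, s'.mem 13 X = m * s.mem 11 X)
      ((hF1.reg 33 rfl).trans hv) ((hF1.reg 1 rfl).trans h1)
      ⟨rfl, rfl, rfl, by decide, by decide⟩ hB hvB ?_ ?_) fun s2 hs2 hF2 =>
    (runs_vcopy (B := B) (Z := Z) (by decide) ?_ ?_ ?_ hB hZB).mono le_rfl ?_).le ?_
  · intro X hX; simpa using hs1 X hX
  · intro m s' _ hI hF hi
    refine (runs_vadd (B := B) (Z := Z) (by decide) ?_ ?_ hB hZB).mono (by simp) ?_
    · rw [hF.reg 1 rfl, hF1.reg 1 rfl, h1]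
    · rw [hF.reg 12 rfl, hF1.reg 12 rfl, hZ]
    · intro s'' h _ X hX
      rw [State.setReg_mem, h X hX, hI X hX, hF.mem 11 rfl, hF1.mem 11 rfl]; ring
  · rw [hF2.reg 1 rfl, hF1.reg 1 rfl, h1]
  · rw [hF2.reg 2 rfl, hF1.reg 2 rfl, h2]
  · rw [hF2.reg 12 rfl, hF1.reg 12 rfl, hZ]
  · intro s3 hs3 _ X hX
    rw [hs3 X hX, hs2 X hX]
  · have : B ≤ B ^ 2 := Nat.le_self_pow (by norm_num) B
    norm_num; omega

/-- The digits are tested by comparison with and subtraction of tabulated powers of two, as there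
are no bit operations. Complementing the sign word is the subtraction `2 ^ D - ·`. -/
theorem runs_nx {i X : ℕ} (hE : Env k s) (hi : s.reg 35 = i) (hX : s.reg 30 = X)
    (hiD : i < k * 2 * 2) (hB : 1 ≤ B) (hDB : k * 2 * 2 ≤ B) :
    Runs .nx s (20 * B) fun s' => s'.reg 36 = nx (k * 2 * 2) i X := by
  set D := k * 2 * 2 with hD
  refine (Runs.seq_of (T₁ := 3) (Q' := fun s' => s'.reg 37 = (scan D X 0).1 ∧
    s'.reg 38 = (scan D X 0).2) ?_ fun s1 hs1 hF1 => Runs.seq1 (Runs.add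
    (Runs.seq1 (Runs.sub (Runs.seq1 (Runs.sub (Runs.seq_of (T₁ := 9 * B) (T₂ := 4)
      (Q' := fun s' => s'.reg 39 = (scan D X (D - 1 - i)).1 ∧ s'.reg 38 = (scan D X (D - 1 - i)).2)
      ?_ ?_))))))).le ?_
  · refine Runs.ifLt (fun h => Runs.seq1 (Runs.add (Runs.const ?_)))
      (fun h => Runs.seq1 (Runs.sub (Runs.add ?_)))
    · rw [hX, hE.half, ← hD] at h
      simp [State.setReg_reg, scan, h, hX, hE.zero]
    · rw [hX, hE.half, ← hD] at h
      simp [State.setReg_reg, scan, h, hX, hE.zero, hE.half, ← hD]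
  · have hE1 := hE.frame hF1 rfl
    refine (Runs.forLt_pow (B := B) (c := 5) (e := 0) (N := D - 1 - i)
      (fun d s' => s'.reg 39 = (scan D X d).1 ∧ s'.reg 38 = (scan D X d).2) ?_ ?_
      ⟨rfl, rfl, rfl, by decide, by decide⟩ hB (by omega) ?_ ?_).le (by simp)
    · simp [State.setReg_reg, hE1.dim, hE1.one, hF1.reg 35 rfl, hi, hD]
    · simp [State.setReg_reg, hE1.one]
    · simp [State.setReg_reg, hs1, hE1.zero]
    · intro m s' hm hI hF hmi
      have e40 : s'.reg 40 = D - 1 := by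
        rw [hF.reg 40 rfl]; simp [State.setReg_reg, hE1.dim, hE1.one, hD]
      have e11 : s'.reg 11 = 2 ^ D := by
        rw [hF.reg 11 rfl]; simp [State.setReg_reg, hE1.half, hD]
      have hpow : s'.mem 7 (D - 1 - m) = 2 ^ (D - 1 - m) := by
        rw [hF.mem 7 rfl]; exact hE1.pow _ (by omega)
      refine (Runs.seq1 (Runs.sub (Runs.seq1 (Runs.load (Runs.ifLt
        (fun h => (Runs.const ?_).le one_le_two)
        (fun h => Runs.seq1 (Runs.sub (Runs.sub ?_)))))))).le (by simp)
      · simp [State.setReg_reg, e40, hmi, hpow, hI.1] at h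
        simp [State.setReg_reg, hI, scan, h]
      · simp [State.setReg_reg, e40, hmi, hpow, hI.1] at h
        simp [State.setReg_reg, hI, scan, e40, e11, hmi, hpow, Nat.not_lt.2 h]
  · intro s2 hs2 hF2
    have hE1 := hE.frame hF1 rfl
    have e35 : s2.reg 35 = i := by
      rw [hF2.reg 35 rfl]; simp [State.setReg_reg, hF1.reg 35 rfl, hi]
    have e37 : s2.reg 37 = (scan D X 0).1 := by
      rw [hF2.reg 37 rfl]; simp [State.setReg_reg, hs1]
    have e12 : s2.reg 12 = 2 ^ (D + 1) := by
      rw [hF2.reg 12 rfl]; simp [State.setReg_reg, hE1.size, hD]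
    have e2 : s2.reg 2 = 0 := by
      rw [hF2.reg 2 rfl]; simp [State.setReg_reg, hE1.zero]
    have hpow : s2.mem 7 i = 2 ^ i := by
      rw [hF2.mem 7 rfl]; exact hE1.pow _ (by omega)
    refine Runs.seq1 (Runs.load (Runs.ifLt
      (fun h => Runs.seq1 (Runs.add (Runs.add ?_)))
      (fun h => Runs.seq1 (Runs.add (Runs.const ?_)))))
    · simp [State.setReg_reg, e35, hpow, hs2.1] at h
      simp [State.setReg_reg, nx, h, e35, hpow, hs2, e37]
    · simp [State.setReg_reg, e35, hpow, hs2.1] at h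
      simp [State.setReg_reg, nx, Nat.not_lt.2 h, e12, e2]
  · omega

/-- The contributions that vanish are collected in cell `2 ^ (D + 1)`, just behind the vector, where
no loop over the vector reads them. -/
theorem runs_push {i : ℕ} (hE : Env k s) (hi : s.reg 35 = i)
    (hiD : i < k * 2 * 2) (hB : 1 ≤ B) (hDB : k * 2 * 2 ≤ B) (hZB : 2 ^ (k * 2 * 2 + 1) ≤ B) :
    Runs .push s (28 * B ^ 2) fun s' =>
      ∀ Y, s'.mem 12 Y = s.mem 12 Y + push (k * 2 * 2) i (s.mem 11) Y := by
  refine (Runs.forLt_pow (B := B) (c := 24) (e := 1)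
    (fun m s' => ∀ Y, s'.mem 12 Y = s.mem 12 Y +
      ∑ X ∈ range m, if nx (k * 2 * 2) i X = Y then s.mem 11 X else 0)
    hE.size hE.one ⟨rfl, rfl, rfl, by decide, by decide⟩ hB hZB (by simp) ?_).le (by norm_num)
  intro m s' hm hI hF hmi
  have hE' := hE.frame hF rfl
  refine (Runs.seq_of (runs_nx (B := B) hE' ((hF.reg 35 rfl).trans hi) hmi hiD hB hDB)
    fun s1 hs1 hF1 => Runs.seq1 (Runs.load (Runs.seq1 (Runs.load (Runs.seq1 (Runs.add
      (Runs.store ?_))))))).le (by simp; omega)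
  intro Y
  have e30 : s1.reg 30 = m := by rw [hF1.reg 30 rfl, hmi]
  have e11 : s1.mem 11 = s.mem 11 := by rw [hF1.mem 11 rfl, hF.mem 11 rfl]
  have e12 : s1.mem 12 = s'.mem 12 := hF1.mem 12 rfl
  simp only [State.setReg_mem, State.setMem_mem_self, sum_range_succ]
  by_cases hY : nx (k * 2 * 2) i m = Y
  · subst hY
    simp [State.setReg_reg, hs1, e30, e11, e12, hI]
    ring
  · rw [Function.update_of_ne (by simpa [State.setReg_reg, hs1] using fun h => hY h.symm),
      if_neg hY, e12, hI, add_zero]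

theorem push_congr {D i : ℕ} {f g : ℕ → ℕ} (h : ∀ X < 2 ^ (D + 1), f X = g X) (Y : ℕ) :
    push D i f Y = push D i g Y :=
  sum_congr rfl fun X hX => by rw [h X (mem_range.1 hX)]

theorem push_smul {D i c : ℕ} {f : ℕ → ℕ} (Y : ℕ) :
    push D i (fun X => c * f X) Y = c * push D i f Y := by
  simp [push, mul_sum]

/-- The powers `v ^ j` are not computed. After `j` rounds array `11` holds `v ^ j` times the
original vector, and linearity of `push` moves this factor outside. -/
theorem runs_wedge {v side : ℕ} (hs : side < 2) (hE : Env k s) (hv : s.reg 33 = v)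
    (hB : 1 ≤ B) (hDB : k * 2 * 2 ≤ B) (hZB : 2 ^ (k * 2 * 2 + 1) ≤ B) (hvB : v ≤ B) :
    Runs (.wedge side) s (90 * B ^ 3) fun s' =>
      ∀ Y < 2 ^ (k * 2 * 2 + 1), s'.mem 11 Y = wedge (k * 2) v side (s.mem 11) Y := by
  refine (Runs.seq_of (runs_vzero 12 hE.one hE.zero hE.size hB hZB) fun s1 hs1 hF1 =>
    -- The constant `60` is `28` for `push`, `30` for `scale` and `2` for advancing the index.
    Runs.seq1 (Runs.const (Runs.seq_of (Runs.forLt_pow (B := B) (c := 60) (e := 2) (N := k * 2)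
      (fun m s' => s'.reg 35 = 2 * m + side ∧
        (∀ X < 2 ^ (k * 2 * 2 + 1), s'.mem 11 X = v ^ m * s.mem 11 X) ∧
        ∀ Y < 2 ^ (k * 2 * 2 + 1), s'.mem 12 Y =
          ∑ j ∈ range m, v ^ j * push (k * 2 * 2) (2 * j + side) (s.mem 11) Y)
      ?_ ?_ ⟨rfl, rfl, rfl, by decide, by decide⟩ hB (by omega) ?_ ?_) fun s2 hs2 hF2 =>
      (runs_vcopy (B := B) (Z := 2 ^ (k * 2 * 2 + 1)) (by decide) ?_ ?_ ?_ hB hZB).mono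
        le_rfl ?_))).le ?_
  · have hE1 := hE.frame hF1 rfl
    simp [State.setReg_reg, hE1.verts]
  · have hE1 := hE.frame hF1 rfl
    simp [State.setReg_reg, hE1.one]
  · have := hF1.mem 11 rfl
    simp only [State.setReg_mem, this]
    simp [State.setReg_reg]
    exact hs1
  · intro m s' hm hI hF hmi
    have hE1 := hE.frame hF1 rfl
    have hE2 := (hE1.setReg (r := 35) (by norm_num) side).frame hF rfl
    have e33 : s'.reg 33 = v := by
      rw [hF.reg 33 rfl]; simp [State.setReg_reg, hF1.reg 33 rfl, hv]
    refine (Runs.seq_of (runs_push hE2 hI.1 (by omega) hB hDB hZB) fun s3 hs3 hF3 =>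
      Runs.seq1 (Runs.add (Runs.seq1 (Runs.add
        ((runs_scale (B := B) (v := v) (Z := 2 ^ (k * 2 * 2 + 1)) ?_ ?_ ?_ ?_ hB hZB hvB).mono
          le_rfl ?_))))).le ?_
    · simp [State.setReg_reg, hF3.reg 1 rfl, hE2.one]
    · simp [State.setReg_reg, hF3.reg 2 rfl, hE2.zero]
    · simp [State.setReg_reg, hF3.reg 12 rfl, hE2.size]
    · simp [State.setReg_reg, hF3.reg 33 rfl, e33]
    · intro s4 hs4 hF4
      have e12 := hF4.mem 12 rfl
      have e35 := hF4.reg 35 rfl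
      have e11 : s3.mem 11 = s'.mem 11 := hF3.mem 11 rfl
      refine ⟨?_, ?_, ?_⟩
      · simp [State.setReg_reg, e35, hF3.reg 35 rfl, hF3.reg 1 rfl, hI.1, hE2.one]
        ring
      · intro X hX
        rw [State.setReg_mem, hs4 X hX]
        simp only [State.setReg_mem]
        rw [e11, hI.2.1 X hX]; ring
      · intro Y hY
        rw [State.setReg_mem, e12]
        simp only [State.setReg_mem]
        rw [hs3, hI.2.2 Y hY, sum_range_succ, push_congr hI.2.1, push_smul]
    · have : 1 ≤ B ^ 2 := Nat.one_le_pow _ _ hB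
      omega
  · have hE1 := hE.frame hF1 rfl
    rw [hF2.reg 1 rfl]; simp [State.setReg_reg, hE1.one]
  · have hE1 := hE.frame hF1 rfl
    rw [hF2.reg 2 rfl]; simp [State.setReg_reg, hE1.zero]
  · have hE1 := hE.frame hF1 rfl
    rw [hF2.reg 12 rfl]; simp [State.setReg_reg, hE1.size]
  · intro s3 hs3 _ Y hY
    rw [hs3 Y hY, hs2.2.2 Y hY, wedge]
  · have h1 : B ≤ B ^ 3 := Nat.le_self_pow (by norm_num) B
    norm_num
    omega

theorem wedge_congr {K v side : ℕ} {f g : ℕ → ℕ} (h : ∀ X < 2 ^ (K * 2 + 1), f X = g X) (Y : ℕ) :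
    wedge K v side f Y = wedge K v side g Y :=
  sum_congr rfl fun j _ => by rw [push_congr h]

theorem wedgeVertex_congr {K v : ℕ} {f g : ℕ → ℕ} (h : ∀ X < 2 ^ (K * 2 + 1), f X = g X) (Y : ℕ) :
    wedgeVertex K v f Y = wedgeVertex K v g Y :=
  wedge_congr (fun X _ => wedge_congr h X) Y

theorem runs_wedgeVertex {v : ℕ} (hE : Env k s) (hv : s.reg 33 = v)
    (hB : 1 ≤ B) (hDB : k * 2 * 2 ≤ B) (hZB : 2 ^ (k * 2 * 2 + 1) ≤ B) (hvB : v ≤ B) :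
    Runs .wedgeVertex s (180 * B ^ 3) fun s' =>
      ∀ Y < 2 ^ (k * 2 * 2 + 1), s'.mem 11 Y = wedgeVertex (k * 2) v (s.mem 11) Y := by
  refine (Runs.seq_of (runs_wedge (by norm_num) hE hv hB hDB hZB hvB) fun s1 hs1 hF1 =>
    (runs_wedge (by norm_num) (hE.frame hF1 rfl) ((hF1.reg 33 rfl).trans hv) hB hDB hZB hvB).mono
      le_rfl ?_).le (by omega)
  intro s2 hs2 _ Y hY
  rw [hs2 Y hY, wedgeVertex, wedge_congr hs1]

end


/-! ### The decision procedure for a fixed edge colouring -/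

theorem wedge_add (K v side : ℕ) (f g : ℕ → ℕ) :
    wedge K v side (fun X => f X + g X) = fun Y => wedge K v side f Y + wedge K v side g Y := by
  funext Y
  simp only [wedge, push, ← sum_add_distrib, ← mul_add]
  refine sum_congr rfl fun j _ => congrArg _ (sum_congr rfl fun X _ => ?_)
  split_ifs <;> rfl

theorem wedge_zero (K v side : ℕ) : wedge K v side (fun _ => 0) = fun _ => 0 := by
  funext Y
  simp [wedge, push]

theorem wordSum_append (eu ev : ℕ → ℕ) (K : ℕ) (ws ws' : List (List ℕ)) (X : ℕ) :
    wordSum eu ev K (ws ++ ws') X = wordSum eu ev K ws X + wordSum eu ev K ws' X := by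
  simp [wordSum]

/-- Distributivity: prefixing all words by an edge is one multiplication of the whole sum. This
avoids enumerating the words. -/
theorem wordSum_map_cons (eu ev : ℕ → ℕ) (K : ℕ) (ws : List (List ℕ)) (e : ℕ) :
    wordSum eu ev K (ws.map (e :: ·)) =
      wedgeVertex K (eu e) (wedgeVertex K (ev e) (wordSum eu ev K ws)) := by
  induction ws with
  | nil =>
    have : wordSum eu ev K [] = fun _ => 0 := rfl
    simp only [List.map_nil, this, wedgeVertex, wedge_zero]
  | cons w ws ih =>
    have h : wordSum eu ev K (w :: ws) = fun X =>
        vertexVec K (endpoints eu ev w) X + wordSum eu ev K ws X := by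
      funext X; simp [wordSum]
    rw [h]
    simp only [wedgeVertex, wedge_add] at ih ⊢
    rw [← ih]
    funext X
    simp [wordSum, endpoints, vertexVec, wedgeVertex]

namespace Prog

/-- Do nothing of importance. -/
def skip : Prog := .const 45 0

/-- Multiply the vector in array `11` by the edge in register `50`. -/
def wedgeEdge : Prog :=
  .seq (.load 33 3 50) (.seq wedgeVertex (.seq (.load 33 2 50) wedgeVertex))

/-- Multiply the vector in array `9` by the sum of the edges of the colour in register `51`. -/
def extend : Prog :=
  .seq (vzero 10) (.seq
    (.forLt 50 15 (.seq (.load 52 4 50) (.ifLt 52 51 skip (.ifLt 51 52 skip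
      (.seq (vcopy 11 9) (.seq wedgeEdge (vadd 10 11)))))))
    (vcopy 9 10))

/-- Treat the colour in register `51`. -/
def colourStep : Prog :=
  .seq (vcopy 9 8) (.seq (vzero 8) (.seq (.const 53 0) (.seq (.const 54 0)
    (.forLt 55 18 (.seq (.ifLt 53 6 skip (.ifLt 8 54 skip (vadd 8 9)))
      (.seq extend (.seq (.add 53 53 7) (.add 54 54 9))))))))

/-- Decide solvability for the current edge colours; the answer is in register `59`. -/
def solvable : Prog :=
  .seq (vzero 8) (.seq (.store 8 2 1) (.seq (.forLt 56 16 (.seq (.load 51 6 56) colourStep))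
    (.seq (.load 57 8 13) (.seq (.load 58 8 14)
      (.ifLt 57 58 (.const 59 1) (.ifLt 58 57 (.const 59 1) (.const 59 0)))))))

end Prog

/-- The state holds an instance with `m` edges and `r` colours, to be solved for size `k`, all of
whose parameters are bounded by `B`. -/
structure Ready (k m r B : ℕ) (s : State) : Prop extends Env k s where
  edges : s.reg 15 = m
  colours : s.reg 16 = r
  size_le : 2 ^ (k * 2 * 2 + 1) ≤ B
  edges_le : m ≤ B
  colours_le : r ≤ B
  left_le : ∀ e < m, s.mem 2 e ≤ B
  right_le : ∀ e < m, s.mem 3 e ≤ B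

theorem Ready.dim_le {k m r B : ℕ} {s : State} (h : Ready k m r B s) : k * 2 * 2 < B :=
  (Nat.lt_of_succ_lt (Nat.lt_two_pow_self (n := k * 2 * 2 + 1))).trans_le h.size_le

theorem Ready.frame {k m r B : ℕ} {s s' : State} {p : Prog} (h : Ready k m r B s)
    (hF : Frame p s s') (hp : p.keepsEnv = true) (h2 : p.stores 2 = false)
    (h3 : p.stores 3 = false) : Ready k m r B s' where
  toEnv := h.toEnv.frame hF hp
  edges := by rw [hF.reg_lt hp (by norm_num), h.edges]
  colours := by rw [hF.reg_lt hp (by norm_num), h.colours]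
  size_le := h.size_le
  edges_le := h.edges_le
  colours_le := h.colours_le
  left_le := by rw [hF.mem 2 h2]; exact h.left_le
  right_le := by rw [hF.mem 3 h3]; exact h.right_le

theorem Ready.setReg {k m r B : ℕ} {s : State} (h : Ready k m r B s) {x : ℕ} (hx : 20 ≤ x)
    (v : ℕ) : Ready k m r B (s.setReg x v) where
  toEnv := h.toEnv.setReg hx v
  edges := by rw [State.setReg_reg_of_ne _ _ (by omega), h.edges]
  colours := by rw [State.setReg_reg_of_ne _ _ (by omega), h.colours]
  size_le := h.size_le
  edges_le := h.edges_le
  colours_le := h.colours_le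
  left_le := h.left_le
  right_le := h.right_le

theorem Ready.setMem {k m r B : ℕ} {s : State} (h : Ready k m r B s) {a : ℕ}
    (ha : a ≠ 2 ∧ a ≠ 3 ∧ a ≠ 7) (i v : ℕ) : Ready k m r B (s.setMem a i v) where
  one := h.one
  zero := h.zero
  dim := h.dim
  half := h.half
  size := h.size
  top := h.top
  top' := h.top'
  verts := h.verts
  succ := h.succ
  pow := by rw [State.setMem_mem, if_neg ha.2.2.symm]; exact h.pow
  edges := h.edges
  colours := h.colours
  size_le := h.size_le
  edges_le := h.edges_le
  colours_le := h.colours_le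
  left_le := by rw [State.setMem_mem, if_neg ha.1.symm]; exact h.left_le
  right_le := by rw [State.setMem_mem, if_neg ha.2.1.symm]; exact h.right_le

section

variable {s : State} {B k m r : ℕ}

theorem runs_wedgeEdge {e : ℕ} (hR : Ready k m r B s) (he : s.reg 50 = e) (hem : e < m) :
    Runs .wedgeEdge s (362 * B ^ 3) fun s' =>
      ∀ Y < 2 ^ (k * 2 * 2 + 1), s'.mem 11 Y =
        wedgeVertex (k * 2) (s.mem 2 e) (wedgeVertex (k * 2) (s.mem 3 e) (s.mem 11)) Y := by
  have hD := hR.dim_le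
  have hB : 1 ≤ B := by omega
  have h1 := hR.setReg (x := 33) (by norm_num) (s.mem 3 e)
  refine (Runs.seq1 (Runs.load (Runs.seq_of (runs_wedgeVertex (B := B) (v := s.mem 3 e)
    (by rw [he]; exact h1.toEnv) (by simp [he]) hB hD.le hR.size_le (hR.right_le e hem))
    fun s1 hs1 hF1 => Runs.seq1 (Runs.load ((runs_wedgeVertex (B := B) (k := k) (v := s.mem 2 e)
      ?_ ?_ hB hD.le hR.size_le (hR.left_le e hem)).mono le_rfl ?_))))).le ?_
  · rw [he] at hF1
    exact ((h1.frame hF1 rfl rfl rfl).setReg (x := 33) (by norm_num) _).toEnv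
  · rw [hF1.mem 2 rfl, hF1.reg 50 rfl]; simp [State.setReg_reg, he]
  · intro s2 hs2 hF2 Y hY
    rw [hs2 Y hY, State.setReg_mem]
    exact wedgeVertex_congr hs1 Y
  · have : 1 ≤ B ^ 3 := Nat.one_le_pow _ _ hB
    omega

theorem extend_succ (m : ℕ) (ec : ℕ → ℕ) (c : ℕ) (ws : List (List ℕ)) :
    extend (m + 1) ec c ws = extend m ec c ws ++ if ec m = c then ws.map (m :: ·) else [] := by
  simp [extend, List.range_succ]

/-- Vector `9` is multiplied by each edge of colour `c` separately, in the work array `11`, and the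
products are accumulated in array `10`. Distinct edges thus start from the same vector. -/
theorem runs_extend {c : ℕ} {ws : List (List ℕ)} (hR : Ready k m r B s) (hc : s.reg 51 = c)
    (hws : ∀ X < 2 ^ (k * 2 * 2 + 1), s.mem 9 X = wordSum (s.mem 2) (s.mem 3) (k * 2) ws X) :
    Runs .extend s (408 * B ^ 4) fun s' => ∀ X < 2 ^ (k * 2 * 2 + 1), s'.mem 9 X =
      wordSum (s.mem 2) (s.mem 3) (k * 2) (extend m (s.mem 4) c ws) X := by
  have hD := hR.dim_le
  have hB : 1 ≤ B := by omega
  refine (Runs.seq_of (runs_vzero 10 hR.one hR.zero hR.size hB hR.size_le) fun s1 hs1 hF1 =>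
    Runs.seq_of (Runs.forLt_pow (B := B) (c := 386) (e := 3) (N := m)
      (fun j s' => ∀ X < 2 ^ (k * 2 * 2 + 1), s'.mem 10 X =
        wordSum (s.mem 2) (s.mem 3) (k * 2) (extend j (s.mem 4) c ws) X)
      ?_ ?_ ⟨rfl, rfl, rfl, by decide, by decide⟩ hB hR.edges_le ?_ ?_) fun s2 hs2 hF2 =>
    (runs_vcopy (B := B) (Z := 2 ^ (k * 2 * 2 + 1)) (by decide) ?_ ?_ ?_ hB hR.size_le).mono
      le_rfl ?_).le ?_
  · exact (hF1.reg 15 rfl).trans hR.edges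
  · exact (hF1.reg 1 rfl).trans hR.one
  · intro X hX; rw [State.setReg_mem, hs1 X hX]; simp [wordSum, extend]
  · intro j s' hj hI hF hji
    have hR1 := hR.frame hF1 rfl rfl rfl
    have hR2 := hR1.frame hF rfl rfl rfl
    have hR3 := hR2.setReg (x := 52) (by norm_num) (s'.mem 4 (s'.reg 50))
    have e4 : s'.mem 4 = s.mem 4 := by rw [hF.mem 4 rfl, hF1.mem 4 rfl]
    have e2 : s'.mem 2 = s.mem 2 := by rw [hF.mem 2 rfl, hF1.mem 2 rfl]
    have e3 : s'.mem 3 = s.mem 3 := by rw [hF.mem 3 rfl, hF1.mem 3 rfl]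
    have e9 : s'.mem 9 = s.mem 9 := by rw [hF.mem 9 rfl, hF1.mem 9 rfl]
    have e51 : s'.reg 51 = c := by rw [hF.reg 51 rfl, hF1.reg 51 rfl, hc]
    have hBB : B ≤ B ^ 3 := Nat.le_self_pow (by norm_num) B
    have hskip : ∀ s₀ : State, s.mem 4 j ≠ c → s₀.mem 10 = s'.mem 10 →
        Runs .skip s₀ (383 * B ^ 3) fun s'' => ∀ X < 2 ^ (k * 2 * 2 + 1),
          (s''.setReg 50 (j + 1)).mem 10 X =
            wordSum (s.mem 2) (s.mem 3) (k * 2) (extend (j + 1) (s.mem 4) c ws) X := by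
      intro s₀ hne h10
      refine (Runs.const ?_).le (by omega)
      intro X hX
      rw [extend_succ, if_neg hne, List.append_nil, ← hI X hX]
      simp [h10]
    -- Equality of colours is tested by two strict comparisons, both of which must fail.
    refine (Runs.seq1 (Runs.load (Runs.ifLt (T := 383 * B ^ 3 + 1)
      (fun h => Runs.le (T := 383 * B ^ 3) (hskip _ ?_ rfl) (by omega))
      (fun h => Runs.ifLt (fun h' => hskip _ ?_ rfl) fun h' => ?_)))).le (by omega)
    · simp [State.setReg_reg, hji, e4, e51] at h; omega
    · simp [State.setReg_reg, hji, e4, e51] at h'; omega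
    · have hjc : s.mem 4 j = c := by
        simp [State.setReg_reg, hji, e4, e51] at h h'; omega
      refine (Runs.seq_of (runs_vcopy (B := B) (by decide) hR3.one hR3.zero hR3.size hB hR.size_le)
        fun s3 hs3 hF3 => Runs.seq_of (runs_wedgeEdge (e := j) (hR3.frame hF3 rfl rfl rfl) ?_ hj)
        fun s4 hs4 hF4 => (runs_vadd (B := B) (Z := 2 ^ (k * 2 * 2 + 1)) (by decide) ?_ ?_ hB
          hR.size_le).mono le_rfl ?_).le ?_
      · rw [hF3.reg 50 rfl]; simp [State.setReg_reg, hji]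
      · exact ((hR3.frame hF3 rfl rfl rfl).frame hF4 rfl rfl rfl).one
      · exact ((hR3.frame hF3 rfl rfl rfl).frame hF4 rfl rfl rfl).size
      · intro s5 hs5 _ X hX
        rw [State.setReg_mem, hs5 X hX, extend_succ, if_pos hjc, wordSum_append, ← hI X hX,
          hF4.mem 10 rfl, hF3.mem 10 rfl, hs4 X hX, hF3.mem 2 rfl, hF3.mem 3 rfl,
          wordSum_map_cons, State.setReg_mem, e2, e3]
        refine congrArg (fun y : ℕ => s'.mem 10 X + y) ?_
        refine wedgeVertex_congr (fun X hX => wedgeVertex_congr (fun X hX => ?_) X) X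
        rw [hs3 X hX, State.setReg_mem, e9, hws X hX]
      · omega
  · exact ((hR.frame hF1 rfl rfl rfl).frame hF2 rfl rfl rfl).one
  · exact ((hR.frame hF1 rfl rfl rfl).frame hF2 rfl rfl rfl).zero
  · exact ((hR.frame hF1 rfl rfl rfl).frame hF2 rfl rfl rfl).size
  · intro s3 hs3 _ X hX
    rw [hs3 X hX, hs2 X hX]
  · have hBB : B ≤ B ^ 4 := Nat.le_self_pow (by norm_num) B
    norm_num; omega

/-- The numbers of edges of a colour that the bounds in the registers of `s` admit. -/
def admissible (s : State) (i : ℕ) : Prop := s.reg 6 ≤ i * s.reg 7 ∧ i * s.reg 9 ≤ s.reg 8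

instance (s : State) : DecidablePred (admissible s) :=
  fun _ => inferInstanceAs (Decidable (_ ∧ _))

/-- Array `9` runs through the iterates of `extend`, and those with an admissible exponent are added
to array `8`. Registers `53` and `54` carry `i` times the denominators, so admissibility takes two
comparisons and no multiplication. -/
theorem runs_colourStep {c : ℕ} {ws : List (List ℕ)} (hR : Ready k m r B s) (hc : s.reg 51 = c)
    (hws : ∀ X < 2 ^ (k * 2 * 2 + 1), s.mem 8 X = wordSum (s.mem 2) (s.mem 3) (k * 2) ws X) :
    Runs .colourStep s (450 * B ^ 5) fun s' => ∀ X < 2 ^ (k * 2 * 2 + 1), s'.mem 8 X =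
      wordSum (s.mem 2) (s.mem 3) (k * 2) (colourStep m k (admissible s) (s.mem 4) c ws) X := by
  have hD := hR.dim_le
  have hB : 1 ≤ B := by omega
  have hkB : k + 1 ≤ B := by omega
  refine (Runs.seq_of (runs_vcopy (B := B) (by decide) hR.one hR.zero hR.size hB hR.size_le)
    fun s1 hs1 hF1 => Runs.seq_of (runs_vzero (B := B) (Z := 2 ^ (k * 2 * 2 + 1)) 8 ?_ ?_ ?_ hB
      hR.size_le) fun s2 hs2 hF2 => Runs.seq1 (Runs.const (Runs.seq1 (Runs.const
      ((Runs.forLt_pow (B := B) (c := 422) (e := 4) (N := k + 1)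
      (fun i s' => s'.reg 53 = i * s.reg 7 ∧ s'.reg 54 = i * s.reg 9 ∧
        (∀ X < 2 ^ (k * 2 * 2 + 1), s'.mem 9 X =
          wordSum (s.mem 2) (s.mem 3) (k * 2) ((extend m (s.mem 4) c)^[i] ws) X) ∧
        ∀ X < 2 ^ (k * 2 * 2 + 1), s'.mem 8 X =
          wordSum (s.mem 2) (s.mem 3) (k * 2) ((List.range i).flatMap fun i =>
            if admissible s i then (extend m (s.mem 4) c)^[i] ws else []) X)
      ?_ ?_ ⟨rfl, rfl, rfl, by decide, by decide⟩ hB hkB ?_ ?_).mono le_rfl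
        fun s' h _ => h.2.2.2))))).le ?_
  · exact (hR.frame hF1 rfl rfl rfl).one
  · exact (hR.frame hF1 rfl rfl rfl).zero
  · exact (hR.frame hF1 rfl rfl rfl).size
  · have := ((hR.frame hF1 rfl rfl rfl).frame hF2 rfl rfl rfl).succ
    simp [State.setReg_reg, this]
  · have := ((hR.frame hF1 rfl rfl rfl).frame hF2 rfl rfl rfl).one
    simp [State.setReg_reg, this]
  · have e9 := hF2.mem 9 rfl
    refine ⟨by simp [State.setReg_reg], by simp [State.setReg_reg], fun X hX => ?_, fun X hX => ?_⟩
    · simp only [State.setReg_mem, e9]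
      rw [hs1 X hX, hws X hX]; rfl
    · simp only [State.setReg_mem]
      rw [hs2 X hX]; simp [wordSum]
  · intro i s' hi hI hF hmi
    have hR2 := (hR.frame hF1 rfl rfl rfl).frame hF2 rfl rfl rfl
    have hR3 := (((hR2.setReg (x := 53) (by norm_num) 0).setReg (x := 54) (by norm_num) 0)).frame
      hF rfl rfl rfl
    have hreg : ∀ x < 20, s'.reg x = s.reg x := by
      intro x hx
      rw [hF.reg_lt rfl hx, State.setReg_reg_of_ne _ _ (by omega),
        State.setReg_reg_of_ne _ _ (by omega), hF2.reg_lt rfl hx, hF1.reg_lt rfl hx]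
    have e2 : s'.mem 2 = s.mem 2 := by
      rw [hF.mem 2 rfl]; simp only [State.setReg_mem]; rw [hF2.mem 2 rfl, hF1.mem 2 rfl]
    have e3 : s'.mem 3 = s.mem 3 := by
      rw [hF.mem 3 rfl]; simp only [State.setReg_mem]; rw [hF2.mem 3 rfl, hF1.mem 3 rfl]
    have e4 : s'.mem 4 = s.mem 4 := by
      rw [hF.mem 4 rfl]; simp only [State.setReg_mem]; rw [hF2.mem 4 rfl, hF1.mem 4 rfl]
    have e51 : s'.reg 51 = c := by
      rw [hF.reg 51 rfl]; simp [State.setReg_reg, hF2.reg 51 rfl, hF1.reg 51 rfl, hc]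
    have hr : ∀ X, X < 2 ^ (k * 2 * 2 + 1) →
        wordSum (s.mem 2) (s.mem 3) (k * 2) ((List.range (i + 1)).flatMap fun i =>
          if admissible s i then (extend m (s.mem 4) c)^[i] ws else []) X = s'.mem 8 X +
        wordSum (s.mem 2) (s.mem 3) (k * 2) (if admissible s i then
          (extend m (s.mem 4) c)^[i] ws else []) X := by
      intro X hX
      rw [List.range_succ, List.flatMap_append, wordSum_append, hI.2.2.2 X hX]
      simp
    refine (Runs.seq_of (T₁ := 10 * B) (Q' := fun s'' => ∀ X < 2 ^ (k * 2 * 2 + 1), s''.mem 8 X =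
      wordSum (s.mem 2) (s.mem 3) (k * 2) ((List.range (i + 1)).flatMap fun i =>
        if admissible s i then (extend m (s.mem 4) c)^[i] ws else []) X) ?_ fun s3 hs3 hF3 =>
      Runs.seq_of (runs_extend (c := c) (hR3.frame hF3 rfl rfl rfl)
        (ws := (extend m (s.mem 4) c)^[i] ws) ?_ ?_) fun s4 hs4 hF4 =>
      Runs.seq1 (Runs.add (Runs.add ?_))).le ?_
    · refine (Runs.ifLt (T := 8 * B + 1) (fun h => (Runs.const ?_).le (by omega)) fun h => Runs.ifLt
        (fun h' => (Runs.const ?_).le (by omega)) fun h' =>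
        (runs_vadd (B := B) (Z := 2 ^ (k * 2 * 2 + 1)) (by decide) hR3.one hR3.size hB
          hR.size_le).mono le_rfl ?_).le (by omega)
      · intro X hX
        rw [hI.1, hreg 6 (by norm_num)] at h
        rw [hr X hX, if_neg (fun ha => by unfold admissible at ha; omega)]
        simp [wordSum]
      · intro X hX
        rw [hI.2.1, hreg 8 (by norm_num)] at h'
        rw [hr X hX, if_neg (fun ha => by unfold admissible at ha; omega)]
        simp [wordSum]
      · intro s3 hs3 _ X hX
        rw [hI.1, hreg 6 (by norm_num)] at h
        rw [hI.2.1, hreg 8 (by norm_num)] at h'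
        rw [hs3 X hX, hr X hX, if_pos (by unfold admissible; omega), hI.2.2.1 X hX]
    · rw [hF3.reg 51 rfl, e51]
    · intro X hX
      rw [hF3.mem 9 rfl, hI.2.2.1 X hX, hF3.mem 2 rfl, hF3.mem 3 rfl, e2, e3]
    · refine ⟨?_, ?_, fun X hX => ?_, fun X hX => ?_⟩
      · simp [State.setReg_reg, hF4.reg 53 rfl, hF3.reg 53 rfl, hF4.reg 7 rfl, hF3.reg 7 rfl,
          hreg 7 (by norm_num), hI.1]
        ring
      · simp [State.setReg_reg, hF4.reg 54 rfl, hF3.reg 54 rfl, hF4.reg 9 rfl, hF3.reg 9 rfl,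
          hreg 9 (by norm_num), hI.2.1]
        ring
      · simp only [State.setReg_mem]
        rw [hs4 X hX, hF3.mem 2 rfl, hF3.mem 3 rfl, hF3.mem 4 rfl, e2, e3, e4,
          Function.iterate_succ_apply']
      · simp only [State.setReg_mem]
        rw [hF4.mem 8 rfl, hs3 X hX]
    · have hBB : B ≤ B ^ 4 := Nat.le_self_pow (by norm_num) B
      omega
  · have hBB : B ≤ B ^ 5 := Nat.le_self_pow (by norm_num) B
    norm_num; omega

/-- The procedure starts from the unit of the algebra, whose only nonzero coefficient is at the
empty set. In the end the coefficients of the full set with sign plus and with sign minus differ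
exactly if `topCoeff` is nonzero. -/
theorem runs_solvable (hR : Ready k m r B s)
    (hcl : ∀ q < r, ∀ q' < r, s.mem 6 q = s.mem 6 q' → q = q') :
    Runs .solvable s (470 * B ^ 6) fun s' =>
      s'.reg 59 = 1 ∧ (∃ w, IsSolutionWord m k r (admissible s) (s.mem 2) (s.mem 3) (s.mem 4)
        (s.mem 6) w) ∨
      s'.reg 59 = 0 ∧ ¬ ∃ w, IsSolutionWord m k r (admissible s) (s.mem 2) (s.mem 3) (s.mem 4)
        (s.mem 6) w := by
  have hD := hR.dim_le
  have hB : 1 ≤ B := by omega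
  have hBB : B ≤ B ^ 6 := Nat.le_self_pow (by norm_num) B
  have hBB' : 1 ≤ B ^ 5 := Nat.one_le_pow _ _ hB
  refine (Runs.seq_of (runs_vzero 8 hR.one hR.zero hR.size hB hR.size_le) fun s1 hs1 hF1 =>
    Runs.seq1 (Runs.store (Runs.seq_of (Runs.forLt_pow (B := B) (c := 451) (e := 5) (N := r)
      (fun q s' => ∀ X < 2 ^ (k * 2 * 2 + 1), s'.mem 8 X =
        wordSum (s.mem 2) (s.mem 3) (k * 2) (words m k (admissible s) (s.mem 4) (s.mem 6) q) X)
      ?_ ?_ ⟨rfl, rfl, rfl, by decide, by decide⟩ hB hR.colours_le ?_ ?_) fun s2 hs2 hF2 =>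
      Runs.seq1 (Runs.load (Runs.seq1 (T := 3) ?_))))).le ?_
  · have := (hR.frame hF1 rfl rfl rfl).colours
    simpa using this
  · have := (hR.frame hF1 rfl rfl rfl).one
    simpa using this
  · have h1 := hR.frame hF1 rfl rfl rfl
    intro X hX
    rw [State.setReg_mem, State.setMem_mem_self, h1.one, h1.zero]
    by_cases h : X = 0
    · simp [h, wordSum, words, endpoints, vertexVec]
    · rw [Function.update_of_ne h, hs1 X hX]
      simp [h, wordSum, words, endpoints, vertexVec]
  · intro q s' hq hI hF hqi
    have hR1 := ((hR.frame hF1 rfl rfl rfl).setMem (a := 8) (by decide) (s1.reg 2) (s1.reg 1)).frame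
      hF rfl rfl rfl
    have hreg : ∀ x < 20, s'.reg x = s.reg x := by
      intro x hx
      rw [hF.reg_lt rfl hx, State.setMem_reg, hF1.reg_lt rfl hx]
    have hmem : ∀ a ∈ [2, 3, 4, 6], s'.mem a = s.mem a := by
      intro a ha
      have : a = 2 ∨ a = 3 ∨ a = 4 ∨ a = 6 := by simpa using ha
      rcases this with rfl | rfl | rfl | rfl
      · rw [hF.mem 2 rfl, State.setMem_mem, if_neg (by decide), hF1.mem 2 rfl]
      · rw [hF.mem 3 rfl, State.setMem_mem, if_neg (by decide), hF1.mem 3 rfl]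
      · rw [hF.mem 4 rfl, State.setMem_mem, if_neg (by decide), hF1.mem 4 rfl]
      · rw [hF.mem 6 rfl, State.setMem_mem, if_neg (by decide), hF1.mem 6 rfl]
    have e2 := hmem 2 (by simp)
    have e3 := hmem 3 (by simp)
    have e4 := hmem 4 (by simp)
    have e6 := hmem 6 (by simp)
    refine (Runs.seq1 (Runs.load ((runs_colourStep (c := s.mem 6 q)
      (hR1.setReg (x := 51) (by norm_num) _) ?_ (ws := words m k (admissible s) (s.mem 4) (s.mem 6) q)
      ?_).mono le_rfl ?_))).le (by omega)
    · simp [hqi, e6]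
    · simpa [e2, e3] using hI
    · intro s3 hs3 hF3 X hX
      have : admissible (s'.setReg 51 (s'.mem 6 (s'.reg 56))) = admissible s := by
        funext i
        simp [admissible, State.setReg_reg, hreg]
      rw [State.setReg_mem, hs3 X hX]
      simp only [State.setReg_mem, e2, e3, e4, words]
      congr 2
  · have hR2 := ((hR.frame hF1 rfl rfl rfl).setMem (a := 8) (by decide) (s1.reg 2)
      (s1.reg 1)).frame hF2 rfl rfl rfl
    have hpos : 0 < 2 ^ (k * 2 * 2) := by positivity
    have f1 := hs2 (2 ^ (k * 2 * 2) - 1) (by rw [pow_succ]; omega)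
    have f2 := hs2 (2 ^ (k * 2 * 2 + 1) - 1) (by rw [pow_succ]; omega)
    have key := topCoeff_words_ne_zero_iff (m := m) (k := k) (ok := admissible s) (eu := s.mem 2)
      (ev := s.mem 3) (ec := s.mem 4) hcl
    rw [topCoeff, ← f1, ← f2] at key
    refine Runs.load (Runs.ifLt (fun h => (Runs.const ?_).le one_le_two) fun h =>
      Runs.ifLt (fun h' => Runs.const ?_) fun h' => Runs.const ?_)
    · refine Or.inl ⟨by simp, key.1 ?_⟩
      simp [State.setReg_reg, hR2.top, hR2.top'] at h
      omega
    · refine Or.inl ⟨by simp, key.1 ?_⟩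
      simp [State.setReg_reg, hR2.top, hR2.top'] at h'
      omega
    · refine Or.inr ⟨by simp, fun hw => key.2 hw ?_⟩
      simp [State.setReg_reg, hR2.top, hR2.top'] at h h'
      omega
  · norm_num; omega

end


/-! ### Tables of edges and of occurring colours -/

/-- The edges at the first `pos` positions of a matrix with `n` columns, listed in arrays. -/
structure EdgeTable (ent : ℕ → ℕ → ℕ) (n pos m : ℕ) (eu ev ec : ℕ → ℕ) : Prop where
  sound : ∀ e < m, eu e < ev e ∧ ev e < n ∧ eu e * n + ev e < pos ∧ ec e = ent (eu e) (ev e) ∧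
    ec e ≠ 0
  complete : ∀ u v, u < v → v < n → u * n + v < pos → ent u v ≠ 0 → ∃ e < m, eu e = u ∧ ev e = v
  inj : ∀ e < m, ∀ e' < m, eu e = eu e' → ev e = ev e' → e = e'
  le : m ≤ pos

/-- The distinct colours of the edges, listed in an array. -/
structure ColourTable (m r : ℕ) (ec seen cl : ℕ → ℕ) : Prop where
  seen_edge : ∀ c, seen c ≠ 0 ↔ ∃ e < m, ec e = c
  seen_colour : ∀ c, seen c ≠ 0 ↔ ∃ q < r, cl q = c
  inj : ∀ q < r, ∀ q' < r, cl q = cl q' → q = q'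
  le : r ≤ m

theorem mul_add_inj {n u v u' v' : ℕ} (hv : v < n) (hv' : v' < n) (h : u * n + v = u' * n + v') :
    u = u' ∧ v = v' := by
  have hn : 0 < n := by omega
  have h1 := congrArg (· / n) h
  simp only [mul_comm _ n, Nat.mul_add_div hn, Nat.div_eq_of_lt hv, Nat.div_eq_of_lt hv',
    add_zero] at h1
  subst h1
  exact ⟨rfl, by omega⟩

/-- Only entries strictly above the diagonal are recorded, so that each undirected edge is listed
once; all other entries and the non-edges leave the table unchanged. -/
theorem EdgeTable.skip {ent : ℕ → ℕ → ℕ} {n m u v : ℕ} {eu ev ec : ℕ → ℕ}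
    (h : EdgeTable ent n (u * n + v) m eu ev ec) (hv : v < n) (h0 : ¬ (u < v ∧ ent u v ≠ 0)) :
    EdgeTable ent n (u * n + v + 1) m eu ev ec where
  sound e he := by
    obtain ⟨h1, h2, h3, h4⟩ := h.sound e he
    exact ⟨h1, h2, by omega, h4⟩
  complete u' v' huv hv' hlt hne := by
    by_cases he : u' * n + v' = u * n + v
    · obtain ⟨rfl, rfl⟩ := mul_add_inj hv' hv he
      exact absurd ⟨huv, hne⟩ h0
    · exact h.complete u' v' huv hv' (by omega) hne
  inj := h.inj
  le := h.le.trans (by omega)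

theorem EdgeTable.add {ent : ℕ → ℕ → ℕ} {n m u v : ℕ} {eu ev ec : ℕ → ℕ}
    (h : EdgeTable ent n (u * n + v) m eu ev ec) (huv : u < v) (hv : v < n) (h0 : ent u v ≠ 0) :
    EdgeTable ent n (u * n + v + 1) (m + 1) (Function.update eu m u) (Function.update ev m v)
      (Function.update ec m (ent u v)) where
  sound e he := by
    by_cases hem : e = m
    · subst hem
      simp [huv, hv, h0]
    · simp only [Function.update_of_ne hem]
      obtain ⟨h1, h2, h3, h4⟩ := h.sound e (by omega)
      exact ⟨h1, h2, by omega, h4⟩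
  complete u' v' huv' hv' hlt hne := by
    by_cases he : u' * n + v' = u * n + v
    · obtain ⟨rfl, rfl⟩ := mul_add_inj hv' hv he
      exact ⟨m, by omega, by simp⟩
    · obtain ⟨e, he, h1, h2⟩ := h.complete u' v' huv' hv' (by omega) hne
      have : e ≠ m := by omega
      exact ⟨e, by omega, by simp [this, h1], by simp [this, h2]⟩
  inj e he e' he' h1 h2 := by
    have key : ∀ e < m, ¬ (eu e = u ∧ ev e = v) := by
      rintro e he ⟨rfl, rfl⟩
      have := (h.sound e he).2.2.1
      omega
    by_cases hem : e = m
    · by_cases hem' : e' = m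
      · omega
      · subst hem
        simp only [Function.update_self, Function.update_of_ne hem'] at h1 h2
        exact absurd ⟨h1.symm, h2.symm⟩ (key e' (by omega))
    · by_cases hem' : e' = m
      · subst hem'
        simp only [Function.update_self, Function.update_of_ne hem] at h1 h2
        exact absurd ⟨h1, h2⟩ (key e (by omega))
      · simp only [Function.update_of_ne hem, Function.update_of_ne hem'] at h1 h2
        exact h.inj e (by omega) e' (by omega) h1 h2
  le := Nat.succ_le_succ h.le

theorem exists_lt_succ_update {m c c' : ℕ} {f : ℕ → ℕ} :
    (∃ e < m + 1, Function.update f m c' e = c) ↔ (∃ e < m, f e = c) ∨ c' = c := by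
  constructor
  · rintro ⟨e, he, h⟩
    by_cases hem : e = m
    · subst hem; exact Or.inr (by simpa using h)
    · exact Or.inl ⟨e, by omega, by simpa [hem] using h⟩
  · rintro (⟨e, he, h⟩ | h)
    · have : e ≠ m := by omega
      exact ⟨e, by omega, by simpa [this] using h⟩
    · exact ⟨m, by omega, by simpa using h⟩

theorem ColourTable.add_old {m r c : ℕ} {ec seen cl : ℕ → ℕ} (h : ColourTable m r ec seen cl)
    (hc : seen c ≠ 0) : ColourTable (m + 1) r (Function.update ec m c) seen cl where
  seen_edge c' := by
    rw [exists_lt_succ_update, h.seen_edge c']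
    constructor
    · exact Or.inl
    · rintro (h' | rfl)
      · exact h'
      · exact (h.seen_edge c).1 hc
  seen_colour := h.seen_colour
  inj := h.inj
  le := h.le.trans (by omega)

theorem ColourTable.add_new {m r c : ℕ} {ec seen cl : ℕ → ℕ} (h : ColourTable m r ec seen cl)
    (hc : seen c = 0) : ColourTable (m + 1) (r + 1) (Function.update ec m c)
      (Function.update seen c 1) (Function.update cl r c) where
  seen_edge c' := by
    rw [exists_lt_succ_update, ← h.seen_edge c', Function.update_apply]
    split_ifs with h' <;> simp [h', eq_comm]
    exact fun h'' => absurd h''.symm h'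
  seen_colour c' := by
    rw [exists_lt_succ_update, ← h.seen_colour c', Function.update_apply]
    split_ifs with h' <;> simp [h', eq_comm]
    exact fun h'' => absurd h''.symm h'
  inj q hq q' hq' he := by
    have key : ∀ q < r, cl q ≠ c := fun q hq hqc => (h.seen_colour c).2 ⟨q, hq, hqc⟩ hc
    by_cases h1 : q = r
    · by_cases h2 : q' = r
      · omega
      · rw [h1, Function.update_self, Function.update_of_ne h2] at he
        exact absurd he.symm (key q' (by omega))
    · by_cases h2 : q' = r
      · rw [h2, Function.update_self, Function.update_of_ne h1] at he
        exact absurd he (key q (by omega))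
      · rw [Function.update_of_ne h1, Function.update_of_ne h2] at he
        exact h.inj q (by omega) q' (by omega) he
  le := Nat.succ_le_succ h.le

/-! ### Solution words under deletion of edges -/

/-- Deleting an edge means recolouring it `0`. As `0` is not a listed colour, a solution word avoids
deleted edges and sees only original colours. -/
theorem IsSolutionWord.of_delete {m k r : ℕ} {ok : ℕ → Prop} {eu ev ec ec' cl : ℕ → ℕ} {w : List ℕ}
    (h : IsSolutionWord m k r ok eu ev ec' cl w) (h0 : ∀ q < r, cl q ≠ 0)
    (hec : ∀ e < m, ec' e = ec e ∨ ec' e = 0) : IsSolutionWord m k r ok eu ev ec cl w := by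
  obtain ⟨h1, h2, h3, h4⟩ := h
  have key : ∀ e ∈ w, ec' e = ec e := by
    intro e he
    obtain ⟨hem, q, hq, hqe⟩ := h2 e he
    exact (hec e hem).resolve_right (by rw [hqe]; exact h0 q hq)
  refine ⟨h1, fun e he => by rw [← key e he]; exact h2 e he, h3, fun q hq => ?_⟩
  rw [List.countP_congr (q := fun e => decide (ec' e = cl q)) (fun e he => by rw [key e he])]
  exact h4 q hq

theorem IsSolutionWord.congr {m k r : ℕ} {ok : ℕ → Prop} {eu ev ec ec' cl : ℕ → ℕ} {w : List ℕ}
    (h : IsSolutionWord m k r ok eu ev ec cl w) (hec : ∀ e ∈ w, ec' e = ec e) :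
    IsSolutionWord m k r ok eu ev ec' cl w := by
  obtain ⟨h1, h2, h3, h4⟩ := h
  refine ⟨h1, fun e he => by rw [hec e he]; exact h2 e he, h3, fun q hq => ?_⟩
  rw [List.countP_congr (q := fun e => decide (ec e = cl q)) (fun e he => by rw [hec e he])]
  exact h4 q hq

theorem IsSolutionWord.perm {m k r : ℕ} {ok : ℕ → Prop} {eu ev ec cl : ℕ → ℕ} {w w' : List ℕ}
    (h : IsSolutionWord m k r ok eu ev ec cl w) (hp : w.Perm w') :
    IsSolutionWord m k r ok eu ev ec cl w' := by
  obtain ⟨h1, h2, h3, h4⟩ := h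
  refine ⟨hp.length_eq ▸ h1, fun e he => h2 e (hp.mem_iff.2 he),
    (hp.flatMap_right _).nodup_iff.1 h3, fun q hq => ?_⟩
  rw [← hp.countP_eq]
  exact h4 q hq

theorem IsSolutionWord.nodup {m k r : ℕ} {ok : ℕ → Prop} {eu ev ec cl : ℕ → ℕ} {w : List ℕ}
    (h : IsSolutionWord m k r ok eu ev ec cl w) : w.Nodup := by
  have := h.2.2.1
  clear h
  induction w with
  | nil => simp
  | cons e w ih =>
    simp only [endpoints, List.flatMap_cons, List.nodup_append] at this
    refine List.nodup_cons.2 ⟨fun he => ?_, ih this.2.1⟩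
    exact this.2.2 (eu e) (by simp) (eu e) (List.mem_flatMap.2 ⟨e, he, by simp⟩) rfl

/-- If no edge of a solvable instance can be deleted, then its edges form a solution. -/
theorem isSolutionWord_of_minimal {m k r : ℕ} {ok : ℕ → Prop} {eu ev ec cl : ℕ → ℕ}
    (h0 : ∀ q < r, cl q ≠ 0) (h : ∃ w, IsSolutionWord m k r ok eu ev ec cl w)
    (hmin : ∀ e < m, ec e ≠ 0 →
      ¬ ∃ w, IsSolutionWord m k r ok eu ev (Function.update ec e 0) cl w) :
    IsSolutionWord m k r ok eu ev ec cl ((List.range m).filter fun e => 0 < ec e) := by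
  obtain ⟨w, hw⟩ := h
  refine hw.perm ((List.perm_ext_iff_of_nodup hw.nodup (List.nodup_range.filter _)).2 fun e => ?_)
  simp only [List.mem_filter, List.mem_range, decide_eq_true_eq]
  constructor
  · intro he
    obtain ⟨hem, q, hq, hqe⟩ := hw.2.1 e he
    have := h0 q hq
    exact ⟨hem, by omega⟩
  · rintro ⟨hem, hpos⟩
    by_contra he
    -- An undeleted edge outside `w` could be deleted without affecting `w`, against minimality.
    refine hmin e hem (by omega) ⟨w, hw.congr fun e' he' => ?_⟩
    rw [Function.update_of_ne]
    rintro rfl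
    exact he he'

/-! ### Solution words and balanced matchings -/

/-- Clearing denominators puts the condition into natural numbers that the machine can compare. -/
theorem le_div_iff_num {α : ℚ} (h0 : 0 ≤ α) {c k : ℕ} (hk : 0 < k) :
    α ≤ (c : ℚ) / k ↔ k * α.num.toNat ≤ c * α.den := by
  have hd : (0 : ℚ) < α.den := by exact_mod_cast α.den_pos
  have hk' : (0 : ℚ) < k := by exact_mod_cast hk
  have hn : ((α.num.toNat : ℕ) : ℚ) = α.num := by
    exact_mod_cast Int.toNat_of_nonneg (Rat.num_nonneg.2 h0)
  have : α = α.num.toNat / α.den := by rw [hn, Rat.num_div_den]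
  rw [this, div_le_div_iff₀ hd hk', ← this, mul_comm]
  exact_mod_cast Iff.rfl

theorem div_le_iff_num {β : ℚ} (h0 : 0 ≤ β) {c k : ℕ} (hk : 0 < k) :
    (c : ℚ) / k ≤ β ↔ c * β.den ≤ k * β.num.toNat := by
  have hd : (0 : ℚ) < β.den := by exact_mod_cast β.den_pos
  have hk' : (0 : ℚ) < k := by exact_mod_cast hk
  have hn : ((β.num.toNat : ℕ) : ℚ) = β.num := by
    exact_mod_cast Int.toNat_of_nonneg (Rat.num_nonneg.2 h0)
  have : β = β.num.toNat / β.den := by rw [hn, Rat.num_div_den]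
  rw [this, div_le_div_iff₀ hk' hd, ← this, mul_comm (β.num.toNat : ℚ)]
  exact_mod_cast Iff.rfl

namespace Instance

variable (I : Instance)

/-- The coloured adjacency matrix, extended by zeros. -/
noncomputable def ent (u v : ℕ) : ℕ :=
  if h : u < I.n ∧ v < I.n then I.entry ⟨u, h.1⟩ ⟨v, h.2⟩ else 0

/-- The numbers of edges of a colour that are allowed in a balanced matching of size `k`. -/
def allowed (k i : ℕ) : Prop :=
  k * I.α.num.toNat ≤ i * I.α.den ∧ i * I.β.den ≤ k * I.β.num.toNat

theorem entry_eq_succ {u v : Fin I.n} {c : ℕ} :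
    I.entry u v = c + 1 ↔ ∃ h : s(u, v) ∈ I.G.edgeSet, (I.χ ⟨s(u, v), h⟩ : ℕ) = c := by
  rw [entry]
  split_ifs with h
  · simp [h]
  · simp [h]

theorem entry_ne_zero {u v : Fin I.n} : I.entry u v ≠ 0 ↔ s(u, v) ∈ I.G.edgeSet := by
  rw [entry]
  split_ifs with h <;> simp [h]

end Instance

/-- The tables computed from an instance. -/
structure Tables (I : Instance) (m r : ℕ) (eu ev ec seen cl : ℕ → ℕ) : Prop where
  edge : EdgeTable I.ent I.n (I.n * I.n) m eu ev ec
  colour : ColourTable m r ec seen cl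

namespace Tables

variable {I : Instance} {m r : ℕ} {eu ev ec seen cl : ℕ → ℕ}

theorem colour_ne_zero (T : Tables I m r eu ev ec seen cl) {q : ℕ} (hq : q < r) : cl q ≠ 0 := by
  obtain ⟨e, he, hc⟩ := (T.colour.seen_edge _).1 ((T.colour.seen_colour _).2 ⟨q, hq, rfl⟩)
  rw [← hc]
  exact (T.edge.sound e he).2.2.2.2

/-- A bridge from the arrays to the graph: indices below `m` correspond bijectively to edges, each
oriented from its smaller to its larger endpoint. -/
theorem exists_fin (T : Tables I m r eu ev ec seen cl) : ∃ U V : Fin m → Fin I.n,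
    (∀ e, (U e : ℕ) = eu e) ∧ (∀ e, (V e : ℕ) = ev e) ∧ (∀ e, U e < V e) ∧
    (∀ e, I.entry (U e) (V e) = ec e) ∧ (∀ e, s(U e, V e) ∈ I.G.edgeSet) ∧
    (Function.Injective fun e => s(U e, V e)) ∧ ∀ x ∈ I.G.edgeSet, ∃ e, s(U e, V e) = x := by
  have hs := T.edge.sound
  have hent : ∀ e : Fin m, I.entry ⟨eu e, by have := hs e e.2; omega⟩
      ⟨ev e, by have := hs e e.2; omega⟩ = ec e := by
    intro e
    have h := hs e e.2
    have h' := h.2.2.2.1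
    rw [Instance.ent, dif_pos ⟨by omega, by omega⟩] at h'
    exact h'.symm
  have hadj : ∀ e : Fin m, s((⟨eu e, by have := hs e e.2; omega⟩ : Fin I.n),
      (⟨ev e, by have := hs e e.2; omega⟩ : Fin I.n)) ∈ I.G.edgeSet := by
    intro e
    rw [← I.entry_ne_zero, hent]
    exact (hs e e.2).2.2.2.2
  refine ⟨fun e => ⟨eu e, by have := hs e e.2; omega⟩, fun e => ⟨ev e, by have := hs e e.2; omega⟩,
    fun _ => rfl, fun _ => rfl, fun e => (hs e e.2).1, hent, hadj, ?_, ?_⟩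
  · intro e e' h
    have h1 := (hs e e.2).1
    have h2 := (hs e' e'.2).1
    simp only [Sym2.eq_iff, Fin.mk.injEq] at h
    rcases h with h | h
    · exact Fin.ext (T.edge.inj e e.2 e' e'.2 h.1 h.2)
    · omega
  · have key : ∀ a b : Fin I.n, a < b → s(a, b) ∈ I.G.edgeSet → ∃ e < m, eu e = a ∧ ev e = b := by
      intro a b hab h
      refine T.edge.complete a b hab b.2 ?_ ?_
      · have : (a : ℕ) + 1 ≤ I.n := a.2
        have h1 := Nat.mul_le_mul_right I.n this
        have := b.2
        rw [Nat.succ_mul] at h1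
        omega
      · rw [Instance.ent, dif_pos ⟨a.2, b.2⟩]
        exact I.entry_ne_zero.2 h
    intro x
    induction x using Sym2.ind with
    | _ a b =>
      intro h
      rcases lt_trichotomy a b with hab | hab | hab
      · obtain ⟨e, he, h1, h2⟩ := key a b hab h
        exact ⟨⟨e, he⟩, by simp [h1, h2]⟩
      · subst hab
        exact absurd h (by simp)
      · obtain ⟨e, he, h1, h2⟩ := key b a hab (by rwa [Sym2.eq_swap])
        exact ⟨⟨e, he⟩, by simp [h1, h2, Sym2.eq_swap]⟩

theorem allowed_iff_balanced {k : ℕ} (hk : 0 < k) (i : ℕ) :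
    I.allowed k i ↔ I.α ≤ (i : ℚ) / k ∧ (i : ℚ) / k ≤ I.β := by
  rw [Instance.allowed, le_div_iff_num I.α_nonneg hk,
    div_le_iff_num (I.α_nonneg.trans I.α_le_β) hk]

theorem ncard_inter_colorClass {U V : Fin m → Fin I.n}
    (hent : ∀ e, I.entry (U e) (V e) = ec e) (hinj : Function.Injective fun e => s(U e, V e))
    {w : List (Fin m)} (hw : w.Nodup) (c : Fin I.ℓ) :
    (((w.map fun e => s(U e, V e)).toFinset : Set (Sym2 (Fin I.n))) ∩ I.colorClass c).ncard =
      (w.map Fin.val).countP fun e => ec e = c + 1 := by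
  have h : ((w.map fun e => s(U e, V e)).toFinset : Set (Sym2 (Fin I.n))) ∩ I.colorClass c =
      (((w.filter fun e : Fin m => ec e = c + 1).map fun e => s(U e, V e)).toFinset :
        Set (Sym2 (Fin I.n))) := by
    ext x
    simp only [List.coe_toFinset, Set.mem_inter_iff, Set.mem_ofPred_eq, List.mem_map,
      List.mem_filter, decide_eq_true_eq, Instance.colorClass]
    constructor
    · rintro ⟨⟨e, he, rfl⟩, hx, hc⟩
      refine ⟨e, ⟨he, ?_⟩, rfl⟩
      rw [← hent, I.entry_eq_succ]
      exact ⟨hx, by rw [hc]⟩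
    · rintro ⟨e, ⟨he, hc⟩, rfl⟩
      rw [← hent, I.entry_eq_succ] at hc
      obtain ⟨hx, hc⟩ := hc
      exact ⟨⟨e, he, rfl⟩, hx, Fin.ext hc⟩
  rw [h, Set.ncard_coe_finset, List.toFinset_card_of_nodup ((hw.filter _).map hinj), List.length_map,
    List.countP_map, List.countP_eq_length_filter]
  rfl

theorem isMatching_iff {U V : Fin m → Fin I.n} (hU : ∀ e, (U e : ℕ) = eu e)
    (hV : ∀ e, (V e : ℕ) = ev e) (hlt : ∀ e, U e < V e) (hadj : ∀ e, s(U e, V e) ∈ I.G.edgeSet)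
    (hinj : Function.Injective fun e => s(U e, V e)) {w : List (Fin m)} (hw : w.Nodup) :
    I.IsMatching (w.map fun e => s(U e, V e)).toFinset ↔
      (endpoints eu ev (w.map Fin.val)).Nodup := by
  have he : endpoints eu ev (w.map Fin.val) =
      (w.flatMap fun e => [U e, V e]).map Fin.val := by
    simp [endpoints, List.flatMap_map, List.map_flatMap, hU, hV]
  rw [he, List.nodup_map_iff Fin.val_injective, List.nodup_flatMap]
  constructor
  · rintro ⟨-, h⟩
    refine ⟨fun e _ => by simp [(hlt e).ne], hw.pairwise_of_forall_ne fun e he e' he' hne => ?_⟩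
    rw [Function.onFun, List.disjoint_left]
    intro v hv hv'
    refine h s(U e, V e) (by simpa using ⟨e, he, by simp⟩) s(U e', V e')
      (by simpa using ⟨e', he', by simp⟩) (fun h => hne (hinj h)) v ⟨?_, ?_⟩
    · simpa using hv
    · simpa using hv'
  · rintro ⟨-, h⟩
    refine ⟨fun x hx => ?_, fun x hx x' hx' hne v hv => ?_⟩
    · simp only [List.mem_toFinset, List.mem_map] at hx
      obtain ⟨e, -, rfl⟩ := hx
      exact hadj e
    · simp only [List.mem_toFinset, List.mem_map] at hx hx'
      obtain ⟨e, he, rfl⟩ := hx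
      obtain ⟨e', he', rfl⟩ := hx'
      have hd : Std.Symm (Function.onFun List.Disjoint fun e => [U e, V e]) :=
        ⟨fun _ _ h => h.symm⟩
      have := h.forall he he' (fun h => hne (by rw [h]))
      rw [Function.onFun, List.disjoint_left] at this
      exact this (a := v) (by simpa using hv.1) (by simpa using hv.2)

theorem exists_colour (T : Tables I m r eu ev ec seen cl) {q : ℕ} (hq : q < r) :
    ∃ c : Fin I.ℓ, cl q = c + 1 := by
  obtain ⟨U, V, -, -, -, hent, hadj, -, -⟩ := T.exists_fin
  obtain ⟨e, he, hc⟩ := (T.colour.seen_edge _).1 ((T.colour.seen_colour _).2 ⟨q, hq, rfl⟩)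
  rw [← hc, ← hent ⟨e, he⟩]
  exact ⟨_, I.entry_eq_succ.2 ⟨hadj _, rfl⟩⟩

/-- A colour outside the table has count `0`, which satisfies the upper bound always and the lower
bound only if `k * α.num` is zero. Hence `ℓ` enters through a single comparison with `r`, and the
running time does not depend on it. -/
theorem allowed_colours_iff (T : Tables I m r eu ev ec seen cl) {k : ℕ} {w : List ℕ}
    (hw : ∀ e ∈ w, e < m) :
    (∀ c : Fin I.ℓ, I.allowed k (w.countP fun e => ec e = c + 1)) ↔
      ¬ (0 < k * I.α.num.toNat ∧ r < I.ℓ) ∧ ∀ q < r, I.allowed k (w.countP fun e => ec e = cl q) := by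
  choose g hg using fun q : Fin r => T.exists_colour q.2
  have hginj : Function.Injective g := fun q q' h =>
    Fin.ext (T.colour.inj q q.2 q' q'.2 (by rw [hg, hg, h]))
  have hzero : ∀ c : Fin I.ℓ, c ∉ Set.range g → (w.countP fun e => ec e = c + 1) = 0 := by
    intro c hc
    rw [List.countP_eq_zero]
    intro e he
    simp only [decide_eq_true_eq]
    intro h
    obtain ⟨q, hq, hqe⟩ := (T.colour.seen_colour _).1 ((T.colour.seen_edge _).2 ⟨e, hw e he, h⟩)
    refine hc ⟨⟨q, hq⟩, Fin.ext ?_⟩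
    have := hg ⟨q, hq⟩
    simp only at this
    omega
  constructor
  · intro h
    refine ⟨?_, fun q hq => ?_⟩
    · rintro ⟨h1, h2⟩
      obtain ⟨c, hc⟩ : ∃ c, c ∉ Set.range g := by
        by_contra! hs
        have := Fintype.card_le_of_surjective g hs
        simp at this
        omega
      have := (h c).1
      rw [hzero c hc] at this
      omega
    · rw [hg ⟨q, hq⟩]
      exact h _
  · rintro ⟨h1, h2⟩ c
    by_cases hc : c ∈ Set.range g
    · obtain ⟨q, rfl⟩ := hc
      rw [← hg q]
      exact h2 q q.2
    -- A colour missing from the table forces `r < ℓ`, so by `h1` the lower bound is zero and count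
    -- `0` is allowed.
    · have hlt : r < I.ℓ := by
        have := Fintype.card_lt_of_injective_of_notMem g hginj hc
        simpa using this
      rw [hzero c hc, Instance.allowed]
      omega

theorem exists_list_fin {w : List ℕ} (hw : ∀ e ∈ w, e < m) :
    ∃ w' : List (Fin m), w'.map Fin.val = w := by
  induction w with
  | nil => exact ⟨[], rfl⟩
  | cons e w ih =>
    obtain ⟨w', rfl⟩ := ih fun e he => hw e (List.mem_cons_of_mem _ he)
    exact ⟨⟨e, hw e (by simp)⟩ :: w', rfl⟩

/-- A solution word yields a balanced matching. -/
theorem balanced_of_isSolutionWord (T : Tables I m r eu ev ec seen cl) {k : ℕ} (hk : 0 < k)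
    {w : List ℕ} (hw : IsSolutionWord m k r (I.allowed k) eu ev ec cl w)
    (hr : ¬ (0 < k * I.α.num.toNat ∧ r < I.ℓ)) :
    ∃ L : List (Fin I.n × Fin I.n), L.length = k ∧ (L.map fun e => s(e.1, e.2)).Nodup ∧
      I.IsBalancedMatching (L.map fun e => s(e.1, e.2)).toFinset ∧
      endpoints eu ev w = L.flatMap fun e => [(e.1 : ℕ), (e.2 : ℕ)] := by
  obtain ⟨U, V, hU, hV, hlt, hent, hadj, hinj, -⟩ := T.exists_fin
  have hn := hw.nodup
  obtain ⟨h1, h2, h3, h4⟩ := hw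
  have h4' := (T.allowed_colours_iff (fun e he => (h2 e he).1)).2 ⟨hr, h4⟩
  obtain ⟨w', rfl⟩ := exists_list_fin fun e he => (h2 e he).1
  have hn' : w'.Nodup := hn.of_map _
  have hmap : (w'.map fun e => (U e, V e)).map (fun e => s(e.1, e.2)) =
      w'.map fun e => s(U e, V e) := by simp
  refine ⟨w'.map fun e => (U e, V e), by simpa using h1, ?_, ?_, ?_⟩
  · rw [hmap]; exact hn'.map hinj
  · rw [hmap]
    refine ⟨(isMatching_iff hU hV hlt hadj hinj hn').2 h3, fun c => ?_⟩
    rw [ncard_inter_colorClass hent hinj hn', List.toFinset_card_of_nodup (hn'.map hinj)]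
    rw [List.length_map] at h1 ⊢
    rw [h1]
    exact (allowed_iff_balanced hk _).1 (h4' c)
  · simp [endpoints, List.flatMap_map, hU, hV]

/-- A matching is turned into a word by listing the indices of its edges in any order; conversely
the endpoints of a solution word are distinct, so its edges are disjoint. -/
theorem hasSolution_iff (T : Tables I m r eu ev ec seen cl) (k : ℕ+) :
    I.HasSolution k ↔ ¬ (0 < (k : ℕ) * I.α.num.toNat ∧ r < I.ℓ) ∧
      ∃ w, IsSolutionWord m k r (I.allowed k) eu ev ec cl w := by
  constructor
  · rintro ⟨M, ⟨hM, hbal⟩, hcard⟩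
    obtain ⟨U, V, hU, hV, hlt, hent, hadj, hinj, hsurj⟩ := T.exists_fin
    have hn : (Finset.univ.filter fun e : Fin m => s(U e, V e) ∈ M).toList.Nodup :=
      Finset.nodup_toList _
    set w := (Finset.univ.filter fun e : Fin m => s(U e, V e) ∈ M).toList with hwdef
    have hMw : (w.map fun e => s(U e, V e)).toFinset = M := by
      ext x
      simp only [hwdef, List.mem_toFinset, List.mem_map, Finset.mem_toList, Finset.mem_filter,
        Finset.mem_univ, true_and]
      constructor
      · rintro ⟨e, he, rfl⟩; exact he
      · intro hx
        obtain ⟨e, rfl⟩ := hsurj x (hM.1 x hx)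
        exact ⟨e, hx, rfl⟩
    have hlen : w.length = k := by
      rw [← hcard, ← hMw, List.toFinset_card_of_nodup (hn.map hinj), List.length_map]
    have hlt' : ∀ e ∈ w.map Fin.val, e < m := by
      intro e he
      obtain ⟨e', -, rfl⟩ := List.mem_map.1 he
      exact e'.2
    have hcol : ∀ c : Fin I.ℓ, I.allowed k
        ((w.map Fin.val).countP fun e => ec e = c + 1) := by
      intro c
      rw [← ncard_inter_colorClass hent hinj hn, hMw, allowed_iff_balanced k.pos, ← hcard]
      exact hbal c
    obtain ⟨h1, h2⟩ := (T.allowed_colours_iff hlt').1 hcol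
    refine ⟨h1, w.map Fin.val, by simpa using hlen, fun e he => ⟨hlt' e he, ?_⟩,
      (isMatching_iff hU hV hlt hadj hinj hn).1 (by rw [hMw]; exact hM), h2⟩
    obtain ⟨q, hq, h⟩ := (T.colour.seen_colour _).1 ((T.colour.seen_edge _).2 ⟨e, hlt' e he, rfl⟩)
    exact ⟨q, hq, h.symm⟩
  · rintro ⟨hr, w, hw⟩
    obtain ⟨L, h1, h2, h3, -⟩ := T.balanced_of_isSolutionWord k.pos hw hr
    exact ⟨_, h3, by rw [List.toFinset_card_of_nodup h2, List.length_map, h1]⟩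

end Tables


/-! ### Reading the input and preparing the tables -/

namespace Prog

/-- Read `n, ℓ, k` and the bounds into registers. -/
def readHeader : Prog :=
  .seq (.const 1 1) (.seq (.const 20 0) (.seq (.load 3 0 20) (.seq (.add 20 20 1)
  (.seq (.load 4 0 20) (.seq (.add 20 20 1) (.seq (.load 5 0 20) (.seq (.add 20 20 1)
  (.seq (.load 21 0 20) (.seq (.add 20 20 1) (.seq (.load 7 0 20) (.seq (.add 20 20 1)
  (.seq (.load 22 0 20) (.seq (.add 20 20 1) (.load 9 0 20))))))))))))))

/-- Multiply the numerators of the bounds by `k`. -/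
def scaleBounds : Prog :=
  .seq (.const 6 0) (.seq (.forLt 23 5 (.add 6 6 21))
  (.seq (.const 8 0) (.forLt 23 5 (.add 8 8 22))))

/-- Append the edge in registers `25`, `26`, `27` to the list of edges. -/
def addEdge : Prog :=
  .seq (.store 2 15 25) (.seq (.store 3 15 26) (.seq (.store 4 15 27) (.seq (.add 15 15 1)
  (.seq (.load 28 5 27) (.ifLt 28 1
    (.seq (.store 5 27 1) (.seq (.store 6 16 27) (.add 16 16 1))) skip)))))

/-- Build the list of edges and the list of colours. -/
def readEdges : Prog :=
  .seq (.const 15 0) (.seq (.const 16 0) (.seq (.const 20 7)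
    (.forLt 25 3 (.forLt 26 3 (.seq (.load 27 0 20) (.seq (.add 20 20 1)
      (.ifLt 25 26 (.ifLt 2 27 addEdge skip) skip)))))))

/-- Compute the dimension, the table of powers of two and the size of the vectors. -/
def powerTable : Prog :=
  .seq (.add 17 5 5) (.seq (.add 10 17 17) (.seq (.add 18 5 1) (.seq (.const 11 1)
  (.seq (.store 7 2 1) (.seq (.const 24 0)
  (.seq (.forLt 23 10 (.seq (.add 11 11 11) (.seq (.add 24 24 1) (.store 7 24 11))))
  (.seq (.add 12 11 11) (.seq (.sub 13 11 1) (.sub 14 12 1)))))))))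

/-- All computations that precede the decision procedure. -/
def prepare : Prog := .seq readHeader (.seq scaleBounds (.seq readEdges powerTable))

end Prog

section

variable {s : State} {B k : ℕ}

theorem runs_readHeader : Runs .readHeader s 15 fun s' =>
    s'.reg 1 = 1 ∧ s'.reg 3 = s.mem 0 0 ∧ s'.reg 4 = s.mem 0 1 ∧ s'.reg 5 = s.mem 0 2 ∧
    s'.reg 21 = s.mem 0 3 ∧ s'.reg 7 = s.mem 0 4 ∧ s'.reg 22 = s.mem 0 5 ∧
    s'.reg 9 = s.mem 0 6 := by
  refine Runs.seq1 (Runs.const (Runs.seq1 (Runs.const (Runs.seq1 (Runs.load (Runs.seq1 (Runs.add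
    (Runs.seq1 (Runs.load (Runs.seq1 (Runs.add (Runs.seq1 (Runs.load (Runs.seq1 (Runs.add
    (Runs.seq1 (Runs.load (Runs.seq1 (Runs.add (Runs.seq1 (Runs.load (Runs.seq1 (Runs.add
    (Runs.seq1 (Runs.load (Runs.seq1 (Runs.add (Runs.load
      ?_))))))))))))))))))))))))))))
  simp [State.setReg_reg]

/-- The loops count to `k` and not to a numerator: numerators are unbounded in terms of `n` and `k`,
but adding one costs a single step. -/
theorem runs_scaleBounds (h1 : s.reg 1 = 1) (hk : s.reg 5 = k) (hB : 1 ≤ B) (hkB : k ≤ B) :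
    Runs .scaleBounds s (12 * B) fun s' =>
      s'.reg 6 = k * s.reg 21 ∧ s'.reg 8 = k * s.reg 22 := by
  refine (Runs.seq1 (Runs.const (Runs.seq_of (Runs.forLt_pow (B := B) (c := 1) (e := 0) (N := k)
    (fun i s' => s'.reg 6 = i * s.reg 21) ?_ ?_ ⟨rfl, rfl, rfl, by decide, by decide⟩ hB hkB ?_ ?_)
    fun s1 hs1 hF1 => Runs.seq1 (Runs.const
    ((Runs.forLt_pow (B := B) (c := 1) (e := 0) (N := k) (fun i s' => s'.reg 8 = i * s.reg 22) ?_ ?_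
      ⟨rfl, rfl, rfl, by decide, by decide⟩ hB hkB ?_ ?_).mono le_rfl ?_))))).le ?_
  · simp [State.setReg_reg, hk]
  · simp [State.setReg_reg, h1]
  · simp [State.setReg_reg]
  · intro i s' _ hI hF _
    refine (Runs.add ?_).le (by simp)
    have e := hF.reg 21 rfl
    simp only [State.setReg_reg] at e ⊢
    norm_num at e ⊢
    rw [hI, e]; ring
  · simp [State.setReg_reg, hF1.reg 5 rfl, hk]
  · simp [State.setReg_reg, hF1.reg 1 rfl, h1]
  · simp [State.setReg_reg]
  · intro i s' _ hI hF _
    refine (Runs.add ?_).le (by simp)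
    have e := hF.reg 22 rfl
    have e' := hF1.reg 22 rfl
    simp only [State.setReg_reg] at e e' ⊢
    norm_num at e e' ⊢
    rw [hI, e, e']; ring
  · intro s' h hF
    refine ⟨?_, h⟩
    rw [hF.reg 6 rfl]
    simp [State.setReg_reg, hs1]
  · norm_num; omega

/-- The state after the first `pos` entries of the matrix have been read. -/
structure Reading (ent : ℕ → ℕ → ℕ) (n pos : ℕ) (s : State) : Prop where
  ptr : s.reg 20 = 7 + pos
  edge : EdgeTable ent n pos (s.reg 15) (s.mem 2) (s.mem 3) (s.mem 4)
  colour : ColourTable (s.reg 15) (s.reg 16) (s.mem 4) (s.mem 5) (s.mem 6)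

theorem Reading.setReg {ent : ℕ → ℕ → ℕ} {n pos : ℕ} (h : Reading ent n pos s) {r : ℕ}
    (hr : r ≠ 20 ∧ r ≠ 15 ∧ r ≠ 16) (v : ℕ) : Reading ent n pos (s.setReg r v) where
  ptr := by rw [State.setReg_reg_of_ne _ _ hr.1.symm, h.ptr]
  edge := by rw [State.setReg_reg_of_ne _ _ hr.2.1.symm]; exact h.edge
  colour := by
    rw [State.setReg_reg_of_ne _ _ hr.2.1.symm, State.setReg_reg_of_ne _ _ hr.2.2.symm]
    exact h.colour

theorem runs_addEdge {ent : ℕ → ℕ → ℕ} {n u v : ℕ} (h1 : s.reg 1 = 1)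
    (hu : s.reg 25 = u) (hv : s.reg 26 = v) (hc : s.reg 27 = ent u v)
    (huv : u < v) (hvn : v < n) (h0 : ent u v ≠ 0) (hptr : s.reg 20 = 7 + (u * n + v + 1))
    (hE : EdgeTable ent n (u * n + v) (s.reg 15) (s.mem 2) (s.mem 3) (s.mem 4))
    (hC : ColourTable (s.reg 15) (s.reg 16) (s.mem 4) (s.mem 5) (s.mem 6)) :
    Runs .addEdge s 9 fun s' => Reading ent n (u * n + v + 1) s' := by
  refine Runs.seq1 (Runs.store (Runs.seq1 (Runs.store (Runs.seq1 (Runs.store (Runs.seq1 (Runs.add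
    (Runs.seq1 (Runs.load (Runs.ifLt (fun h => Runs.seq1 (Runs.store (Runs.seq1 (Runs.store
      (Runs.add ?_))))) fun h => (Runs.const ?_).le (by norm_num)))))))))))
  · simp [State.setReg_reg, State.setMem_mem, hc, h1] at h
    have a := hE.add huv hvn h0
    have b := hC.add_new h
    constructor
    · simp [State.setReg_reg, hptr]
    · simpa [State.setReg_reg, State.setMem_mem, hu, hv, hc, h1] using a
    · simpa [State.setReg_reg, State.setMem_mem, hu, hv, hc, h1] using b
  · simp [State.setReg_reg, State.setMem_mem, hc, h1] at h
    have a := hE.add huv hvn h0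
    have b := hC.add_old h
    constructor
    · simp [State.setReg_reg, hptr]
    · simpa [State.setReg_reg, State.setMem_mem, hu, hv, hc, h1] using a
    · simpa [State.setReg_reg, State.setMem_mem, hu, hv, hc, h1] using b

theorem runs_readEdges {ent : ℕ → ℕ → ℕ} {n : ℕ} (h1 : s.reg 1 = 1) (h2 : s.reg 2 = 0)
    (hn : s.reg 3 = n) (hent : ∀ u < n, ∀ v < n, s.mem 0 (7 + (u * n + v)) = ent u v)
    (h5 : ∀ c, s.mem 5 c = 0) (hB : 1 ≤ B) (hnB : n ≤ B) :
    Runs .readEdges s (24 * B ^ 2) fun s' => Reading ent n (n * n) s' := by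
  have hBB : 1 ≤ B ^ 2 := Nat.one_le_pow _ _ hB
  refine (Runs.seq1 (Runs.const (Runs.seq1 (Runs.const (Runs.seq1 (Runs.const
    (Runs.forLt_pow (B := B) (c := 17) (e := 1) (N := n) (fun u s' => Reading ent n (u * n) s')
      ?_ ?_ ⟨rfl, rfl, rfl, by decide, by decide⟩ hB hnB ?_ ?_))))))).le ?_
  · simp [State.setReg_reg, hn]
  · simp [State.setReg_reg, h1]
  · constructor
    · simp [State.setReg_reg]
    · constructor <;> simp [State.setReg_reg]
    · constructor <;> simp [State.setReg_reg, h5]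
  · intro u s' hu hI hF hui
    have e1 : s'.reg 1 = 1 := by rw [hF.reg 1 rfl]; simp [State.setReg_reg, h1]
    have e2 : s'.reg 2 = 0 := by rw [hF.reg 2 rfl]; simp [State.setReg_reg, h2]
    have e3 : s'.reg 3 = n := by rw [hF.reg 3 rfl]; simp [State.setReg_reg, hn]
    have e0 : s'.mem 0 = s.mem 0 := hF.mem 0 rfl
    refine (Runs.forLt_pow (B := B) (c := 13) (e := 0) (N := n)
      (fun v s' => Reading ent n (u * n + v) s') e3 e1
      ⟨rfl, rfl, rfl, by decide, by decide⟩ hB hnB ?_ ?_).mono le_rfl ?_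
    · exact hI.setReg (by decide) _
    · intro v s'' hv hI' hF' hvi
      have f1 : s''.reg 1 = 1 := by rw [hF'.reg 1 rfl, e1]
      have f2 : s''.reg 2 = 0 := by rw [hF'.reg 2 rfl, e2]
      have f25 : s''.reg 25 = u := by rw [hF'.reg 25 rfl, hui]
      have f0 : s''.mem 0 (s''.reg 20) = ent u v := by
        rw [hF'.mem 0 rfl, e0, hI'.ptr, hent u hu v hv]
      -- Both ways of skipping an entry, a zero entry and `u ≥ v`, end in this same state.
      have hskip : ¬ (u < v ∧ ent u v ≠ 0) → Reading ent n (u * n + (v + 1))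
          (((((s''.setReg 27 (s''.mem 0 (s''.reg 20))).setReg 20
            ((s''.setReg 27 (s''.mem 0 (s''.reg 20))).reg 20 +
              (s''.setReg 27 (s''.mem 0 (s''.reg 20))).reg 1))).setReg 45 0).setReg 26 (v + 1)) := by
        intro h
        constructor
        · simp [State.setReg_reg, hI'.ptr, f1]; ring
        · have := hI'.edge.skip hv h
          rw [add_assoc] at this
          simpa [State.setReg_reg] using this
        · simpa [State.setReg_reg] using hI'.colour
      refine (Runs.seq1 (Runs.load (Runs.seq1 (Runs.add (Runs.ifLt (T := 10) (fun h => Runs.ifLt (T := 9)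
        (fun h' => (runs_addEdge (ent := ent) (n := n) (u := u) (v := v) ?_ ?_ ?_ ?_ ?_ hv ?_ ?_ ?_
          ?_).mono le_rfl ?_) fun h' => Runs.le (T' := 9) (Runs.const (hskip ?_)) (by norm_num))
        fun h => Runs.le (T' := 10) (Runs.const (hskip ?_)) (by norm_num)))))).le (by norm_num)
      · simp [State.setReg_reg, f1]
      · simp [State.setReg_reg, f25]
      · simp [State.setReg_reg, hvi]
      · simp [State.setReg_reg, f0]
      · simpa [State.setReg_reg, f25, hvi] using h
      · simp [State.setReg_reg, f0, f2] at h'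
        omega
      · simp [State.setReg_reg, hI'.ptr, f1]; ring
      · simpa [State.setReg_reg] using hI'.edge
      · simpa [State.setReg_reg] using hI'.colour
      · intro s3 hs3 _
        exact hs3.setReg (by decide) _
      · simp [State.setReg_reg, f0, f2] at h'
        exact fun hh => hh.2 h'
      · simp [State.setReg_reg, f25, hvi] at h
        exact fun hh => absurd hh.1 (by omega)
    · intro s'' h _
      have h' := h.setReg (r := 25) (by decide) (u + 1)
      rwa [← Nat.succ_mul] at h'
  · norm_num; omega

theorem runs_powerTable (h1 : s.reg 1 = 1) (h2 : s.reg 2 = 0) (hk : s.reg 5 = k) (hB : 1 ≤ B)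
    (hDB : k * 2 * 2 ≤ B) : Runs .powerTable s (20 * B) fun s' => Env k s' := by
  refine (Runs.seq1 (Runs.add (Runs.seq1 (Runs.add (Runs.seq1 (Runs.add (Runs.seq1 (Runs.const
    (Runs.seq1 (Runs.store (Runs.seq1 (Runs.const (Runs.seq_of (T₂ := 3)
    (Runs.forLt_pow (B := B) (c := 3) (e := 0) (N := k * 2 * 2)
      (fun i s' => s'.reg 11 = 2 ^ i ∧ s'.reg 24 = i ∧ ∀ j ≤ i, s'.mem 7 j = 2 ^ j) ?_ ?_
      ⟨rfl, rfl, rfl, by decide, by decide⟩ hB hDB ?_ ?_) fun s1 hs1 hF1 =>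
    Runs.seq1 (Runs.add (Runs.seq1 (Runs.sub (Runs.sub ?_))))))))))))))))).le ?_
  · simp [State.setReg_reg, hk]; ring
  · simp [State.setReg_reg, h1]
  · simp [State.setReg_reg, h1, h2]
  · intro i s' _ hI hF _
    have e1 : s'.reg 1 = 1 := by rw [hF.reg 1 rfl]; simp [State.setReg_reg, h1]
    refine (Runs.seq1 (Runs.add (Runs.seq1 (Runs.add (Runs.store ?_))))).le (by simp)
    refine ⟨by simp [State.setReg_reg, hI.1]; ring, by simp [State.setReg_reg, hI.2.1, e1], ?_⟩
    intro j hj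
    simp only [State.setReg_mem, State.setMem_mem_self, State.setReg_reg]
    norm_num [hI.1, hI.2.1, e1]
    by_cases h : j = i + 1
    · subst h; simp; ring
    · rw [Function.update_of_ne h, hI.2.2 j (by omega)]
  · have e1 : s1.reg 1 = 1 := by rw [hF1.reg 1 rfl]; simp [State.setReg_reg, h1]
    have e2 : s1.reg 2 = 0 := by rw [hF1.reg 2 rfl]; simp [State.setReg_reg, h2]
    have e10 : s1.reg 10 = k * 2 * 2 := by
      rw [hF1.reg 10 rfl]; simp [State.setReg_reg, hk]; ring
    have e17 : s1.reg 17 = k * 2 := by rw [hF1.reg 17 rfl]; simp [State.setReg_reg, hk]; ring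
    have e18 : s1.reg 18 = k + 1 := by rw [hF1.reg 18 rfl]; simp [State.setReg_reg, hk, h1]
    constructor
    · simp [State.setReg_reg, e1]
    · simp [State.setReg_reg, e2]
    · simp [State.setReg_reg, e10]
    · simp [State.setReg_reg, hs1.1]
    · simp [State.setReg_reg, hs1.1]; ring
    · simp [State.setReg_reg, hs1.1, e1]
    · simp [State.setReg_reg, hs1.1, e1, pow_succ, mul_two]
    · simp [State.setReg_reg, e17]
    · simp [State.setReg_reg, e18]
    · simpa using hs1.2.2
  · norm_num; omega

end

theorem Instance.encode_getD (I : Instance) (k : ℕ+) {u v : ℕ} (hu : u < I.n) (hv : v < I.n) :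
    (I.encode k).getD (7 + (u * I.n + v)) 0 = I.ent u v := by
  have hlt : u * I.n + v < I.n * I.n := by
    have := Nat.mul_le_mul_right I.n (Nat.succ_le_of_lt hu)
    rw [Nat.succ_mul] at this
    omega
  have h1 : Fin.divNat ⟨u * I.n + v, hlt⟩ = (⟨u, hu⟩ : Fin I.n) := by
    apply Fin.ext
    simp only [Fin.divNat]
    rw [mul_comm, Nat.mul_add_div (by omega), Nat.div_eq_of_lt hv, add_zero]
  have h2 : Fin.modNat ⟨u * I.n + v, hlt⟩ = (⟨v, hv⟩ : Fin I.n) := by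
    apply Fin.ext
    simp only [Fin.modNat]
    rw [mul_comm, Nat.mul_add_mod, Nat.mod_eq_of_lt hv]
  rw [encode, List.getD_append_right _ _ _ _ (by simp)]
  simp only [List.length_cons, List.length_nil]
  rw [show 7 + (u * I.n + v) - (0 + 1 + 1 + 1 + 1 + 1 + 1 + 1) = u * I.n + v by omega,
    List.getD_eq_getElem _ _ (by simpa using hlt), List.getElem_ofFn, h1, h2, ent,
    dif_pos ⟨hu, hv⟩]

/-- The state after all preparations. -/
structure Prepared (I : Instance) (k : ℕ+) (B : ℕ) (s : State) : Prop where
  ready : Ready k (s.reg 15) (s.reg 16) B s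
  tables : Tables I (s.reg 15) (s.reg 16) (s.mem 2) (s.mem 3) (s.mem 4) (s.mem 5) (s.mem 6)
  admissible_eq : admissible s = I.allowed k
  colours : s.reg 4 = I.ℓ
  bound : s.reg 6 = k * I.α.num.toNat
  output : ∀ i, s.mem 1 i = 0

/-- `B` has to dominate the vector length `2 ^ (4 * k + 1)`, the vertex numbers, and the numbers of
edges and of occurring colours; the last two are at most `n * n`. -/
theorem runs_prepare (I : Instance) (k : ℕ+) {B : ℕ} (hZ : 2 ^ ((k : ℕ) * 2 * 2 + 1) ≤ B)
    (hn : I.n ≤ B) (hnn : I.n * I.n ≤ B) :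
    Runs .prepare (State.init (I.encode k)) (80 * B ^ 2) (Prepared I k B) := by
  have hD : (k : ℕ) * 2 * 2 < B :=
    (Nat.lt_of_succ_lt (Nat.lt_two_pow_self (n := (k : ℕ) * 2 * 2 + 1))).trans_le hZ
  have hB : 1 ≤ B := by omega
  have i0 : ∀ i, (State.init (I.encode k)).mem 0 i = (I.encode k).getD i 0 := fun _ => rfl
  have i2 : (State.init (I.encode k)).reg 2 = 0 := rfl
  have g0 : (I.encode k).getD 0 0 = I.n := rfl
  have g1 : (I.encode k).getD 1 0 = I.ℓ := rfl
  have g2 : (I.encode k).getD 2 0 = k := rfl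
  have g3 : (I.encode k).getD 3 0 = I.α.num.toNat := rfl
  have g4 : (I.encode k).getD 4 0 = I.α.den := rfl
  have g5 : (I.encode k).getD 5 0 = I.β.num.toNat := rfl
  have g6 : (I.encode k).getD 6 0 = I.β.den := rfl
  refine (Runs.seq_of runs_readHeader fun s1 hs1 hF1 => Runs.seq_of
    (runs_scaleBounds (B := B) (k := k) hs1.1 ?_ hB (by omega)) fun s2 hs2 hF2 => Runs.seq_of
    (runs_readEdges (B := B) (n := I.n) (ent := I.ent) ?_ ?_ ?_ ?_ ?_ hB hn) fun s3 hs3 hF3 =>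
    (runs_powerTable (B := B) (k := k) ?_ ?_ ?_ hB hD.le).mono le_rfl ?_).le ?_
  · rw [hs1.2.2.2.1, i0, g2]
  · rw [hF2.reg 1 rfl, hs1.1]
  · rw [hF2.reg 2 rfl, hF1.reg 2 rfl, i2]
  · rw [hF2.reg 3 rfl, hs1.2.1, i0, g0]
  · intro u hu v hv
    rw [hF2.mem 0 rfl, hF1.mem 0 rfl, i0]
    exact I.encode_getD k hu hv
  · intro c
    rw [hF2.mem 5 rfl, hF1.mem 5 rfl]; rfl
  · rw [hF3.reg 1 rfl, hF2.reg 1 rfl, hs1.1]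
  · rw [hF3.reg 2 rfl, hF2.reg 2 rfl, hF1.reg 2 rfl, i2]
  · rw [hF3.reg 5 rfl, hF2.reg 5 rfl, hs1.2.2.2.1, i0, g2]
  · intro s4 hE hF4
    have r6 : s4.reg 6 = k * I.α.num.toNat := by
      rw [hF4.reg 6 rfl, hF3.reg 6 rfl, hs2.1, hs1.2.2.2.2.1, i0, g3]
    have r8 : s4.reg 8 = k * I.β.num.toNat := by
      rw [hF4.reg 8 rfl, hF3.reg 8 rfl, hs2.2, hs1.2.2.2.2.2.2.1, i0, g5]
    have r7 : s4.reg 7 = I.α.den := by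
      rw [hF4.reg 7 rfl, hF3.reg 7 rfl, hF2.reg 7 rfl, hs1.2.2.2.2.2.1, i0, g4]
    have r9 : s4.reg 9 = I.β.den := by
      rw [hF4.reg 9 rfl, hF3.reg 9 rfl, hF2.reg 9 rfl, hs1.2.2.2.2.2.2.2, i0, g6]
    have T : Tables I (s4.reg 15) (s4.reg 16) (s4.mem 2) (s4.mem 3) (s4.mem 4) (s4.mem 5)
        (s4.mem 6) := by
      rw [hF4.reg 15 rfl, hF4.reg 16 rfl, hF4.mem 2 rfl, hF4.mem 3 rfl, hF4.mem 4 rfl,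
        hF4.mem 5 rfl, hF4.mem 6 rfl]
      exact ⟨hs3.edge, hs3.colour⟩
    refine ⟨⟨hE, rfl, rfl, hZ, T.edge.le.trans hnn, (T.colour.le.trans T.edge.le).trans hnn,
      fun e he => ?_, fun e he => ?_⟩, T, ?_, ?_, r6, ?_⟩
    · have := T.edge.sound e he; omega
    · have := T.edge.sound e he; omega
    · funext i
      rw [admissible, Instance.allowed, r6, r7, r8, r9]
    · rw [hF4.reg 4 rfl, hF3.reg 4 rfl, hF2.reg 4 rfl, hs1.2.2.1, i0, g1]
    · intro i
      rw [hF4.mem 1 rfl, hF3.mem 1 rfl, hF2.mem 1 rfl, hF1.mem 1 rfl]; rfl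
  · have hBB : B ≤ B ^ 2 := Nat.le_self_pow (by norm_num) B
    omega


/-! ### Self-reduction, output and the complete algorithm -/

namespace Prog

/-- Decide whether there is a solution; register `60` is set if there is none. -/
def checkSolvable : Prog :=
  .seq (.const 60 0) (.seq (.ifLt 2 6 (.ifLt 16 4 (.const 60 1) skip) skip)
    (.seq solvable (.ifLt 59 1 (.const 60 1) skip)))

/-- Delete edges as long as the instance remains solvable. -/
def reduceEdges : Prog :=
  .forLt 61 15 (.seq (.load 62 4 61) (.seq (.store 4 61 2)
    (.seq solvable (.ifLt 59 1 (.store 4 61 62) skip))))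

/-- Output the remaining edges. -/
def writeEdges : Prog :=
  .seq (.const 63 0) (.seq (.store 1 63 1) (.seq (.const 63 1)
  (.seq (.forLt 61 15 (.seq (.load 62 4 61) (.ifLt 2 62
    (.seq (.load 64 2 61) (.seq (.store 1 63 64) (.seq (.add 63 63 1)
    (.seq (.load 64 3 61) (.seq (.store 1 63 64) (.add 63 63 1)))))) skip)))
  (.add 0 63 2))))

/-- The algorithm: output a balanced matching of size `k`, or `0` if there is none. -/
def findMatching : Prog :=
  .seq prepare (.seq checkSolvable (.ifLt 2 60 (.const 0 1) (.seq reduceEdges writeEdges)))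

end Prog

section

variable {s : State} {B k m r : ℕ}

/-- The invariant says that the instance is still solvable and that every edge already examined is
deleted or indispensable. After the last edge the instance is minimal. -/
theorem runs_reduceEdges (hR : Ready k m r B s)
    (hcl : ∀ q < r, ∀ q' < r, s.mem 6 q = s.mem 6 q' → q = q') (h0 : ∀ q < r, s.mem 6 q ≠ 0)
    (hw : ∃ w, IsSolutionWord m k r (admissible s) (s.mem 2) (s.mem 3) (s.mem 4) (s.mem 6) w) :
    Runs .reduceEdges s (480 * B ^ 7) fun s' =>
      (∀ e, s'.mem 4 e = s.mem 4 e ∨ s'.mem 4 e = 0) ∧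
      IsSolutionWord m k r (admissible s) (s.mem 2) (s.mem 3) (s'.mem 4) (s.mem 6)
        ((List.range m).filter fun e => 0 < s'.mem 4 e) := by
  have hB : 1 ≤ B := by have := hR.dim_le; omega
  have hBB : 1 ≤ B ^ 6 := Nat.one_le_pow _ _ hB
  set sol : (ℕ → ℕ) → Prop := fun ec =>
    ∃ w, IsSolutionWord m k r (admissible s) (s.mem 2) (s.mem 3) ec (s.mem 6) w with hsol
  -- Restoring deleted edges preserves solvability.
  have hmono : ∀ ec ec' : ℕ → ℕ, (∀ e, ec' e = ec e ∨ ec' e = 0) → sol ec' → sol ec :=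
    fun ec ec' h ⟨w, hw⟩ => ⟨w, hw.of_delete h0 fun e _ => h e⟩
  refine (Runs.forLt_pow (B := B) (c := 474) (e := 6) (N := m)
    (fun t s' => (∀ e, s'.mem 4 e = s.mem 4 e ∨ s'.mem 4 e = 0) ∧ sol (s'.mem 4) ∧
      ∀ e < t, s'.mem 4 e ≠ 0 → ¬ sol (Function.update (s'.mem 4) e 0))
    hR.edges hR.one ⟨rfl, rfl, rfl, by decide, by decide⟩ hB hR.edges_le ?_ ?_).mono ?_ ?_
  · exact ⟨fun e => Or.inl rfl, hw, by simp⟩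
  · rintro t s' ht ⟨hI1, hI2, hI3⟩ hF hti
    have hR' := hR.frame hF rfl rfl rfl
    have hR1 := (hR'.setReg (x := 62) (by norm_num) (s'.mem 4 (s'.reg 61))).setMem (a := 4)
      (by decide) t 0
    have e2 : s'.mem 2 = s.mem 2 := hF.mem 2 rfl
    have e3 : s'.mem 3 = s.mem 3 := hF.mem 3 rfl
    have e6 : s'.mem 6 = s.mem 6 := hF.mem 6 rfl
    have hzero : s'.reg 2 = 0 := hR'.zero
    have hstate : (s'.setReg 62 (s'.mem 4 (s'.reg 61))).setMem 4
        ((s'.setReg 62 (s'.mem 4 (s'.reg 61))).reg 61)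
        ((s'.setReg 62 (s'.mem 4 (s'.reg 61))).reg 2) =
        (s'.setReg 62 (s'.mem 4 t)).setMem 4 t 0 := by
      simp [State.setReg_reg, hti, hzero]
    rw [hti] at hR1
    have hadm : admissible ((s'.setReg 62 (s'.mem 4 t)).setMem 4 t 0) = admissible s := by
      funext i
      simp [admissible, State.setReg_reg, hF.reg 6 rfl, hF.reg 7 rfl, hF.reg 8 rfl, hF.reg 9 rfl]
    refine (Runs.seq1 (Runs.load (Runs.seq1 (Runs.store ?_)))).le
      (T := 470 * B ^ 6 + 2 + 1 + 1) (by omega)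
    rw [hstate]
    refine Runs.seq_of (runs_solvable (B := B) hR1 ?_) fun s2 hs2 hF2 =>
      Runs.ifLt (fun h => Runs.store ?_) fun h => Runs.const ?_
    · simpa [State.setMem_mem, e6] using hcl
    · simp only [hadm] at hs2
      simp [State.setMem_mem, e2, e3, e6] at hs2
      have hns : ¬ sol (Function.update (s'.mem 4) t 0) := by
        rcases hs2 with hs2 | hs2
        · rw [hs2.1, hF2.reg 1 rfl] at h
          have := hR1.one
          omega
        · rintro ⟨w, hw⟩
          exact hs2.2 w hw
      have e61 : s2.reg 61 = t := by
        rw [hF2.reg 61 rfl]; simp [State.setReg_reg, hti]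
      have e62 : s2.reg 62 = s'.mem 4 t := by
        rw [hF2.reg 62 rfl]; simp
      have e4 : s2.mem 4 = Function.update (s'.mem 4) t 0 := by
        rw [hF2.mem 4 rfl]; simp
      have e4' : ((s2.setMem 4 (s2.reg 61) (s2.reg 62)).setReg 61 (t + 1)).mem 4 = s'.mem 4 := by
        simp [e61, e62, e4]
      rw [e4']
      refine ⟨hI1, hI2, fun e he => ?_⟩
      by_cases het : e = t
      · subst het
        exact fun _ => hns
      · exact hI3 e (by omega)
    · simp only [hadm] at hs2
      simp [State.setMem_mem, e2, e3, e6] at hs2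
      have hs : sol (Function.update (s'.mem 4) t 0) := by
        rcases hs2 with hs2 | hs2
        · exact hs2.2
        · rw [hs2.1, hF2.reg 1 rfl] at h
          have := hR1.one
          omega
      have e4 : ((s2.setReg 45 0).setReg 61 (t + 1)).mem 4 = Function.update (s'.mem 4) t 0 := by
        simp [hF2.mem 4 rfl]
      rw [e4]
      refine ⟨fun e => ?_, hs, fun e he hne => ?_⟩
      · by_cases het : e = t
        · simp [het]
        · rw [Function.update_of_ne het]; exact hI1 e
      · have het : e ≠ t := by
          rintro rfl
          simp at hne
        rw [Function.update_of_ne het] at hne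
        -- An edge found indispensable earlier stays so: if it could be deleted along with `t`, then
        -- by monotonicity it could have been deleted alone.
        refine fun hs' => hI3 e (by omega) hne (hmono _ _ (fun e' => ?_) hs')
        by_cases h1 : e' = e
        · simp [h1]
        · by_cases h2 : e' = t
          · subst h2; right; simp [h1]
          · left; simp [h1, h2]
  · norm_num; omega
  · rintro s' ⟨h1, h2, h3⟩ _
    exact ⟨h1, isSolutionWord_of_minimal h0 h2 h3⟩

theorem map_range_succ_update {N v : ℕ} {f : ℕ → ℕ} {l : List ℕ}
    (h : (List.range N).map f = l) :
    (List.range (N + 1)).map (Function.update f N v) = l ++ [v] := by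
  rw [List.range_succ, List.map_append, ← h]
  congr 1
  · refine List.map_congr_left fun i hi => Function.update_of_ne ?_ _ _
    have := List.mem_range.1 hi
    omega
  · simp

theorem runs_writeEdges (h1 : s.reg 1 = 1) (h2 : s.reg 2 = 0) (hm : s.reg 15 = m) (hB : 1 ≤ B)
    (hmB : m ≤ B) : Runs .writeEdges s (20 * B) fun s' => s'.output =
      1 :: endpoints (s.mem 2) (s.mem 3) ((List.range m).filter fun e => 0 < s.mem 4 e) := by
  refine (Runs.seq1 (Runs.const (Runs.seq1 (Runs.store (Runs.seq1 (Runs.const (Runs.seq_of (T₂ := 1)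
    (Runs.forLt_pow (B := B) (c := 8) (e := 0) (N := m)
      (fun j s' => (List.range (s'.reg 63)).map (s'.mem 1) =
        1 :: endpoints (s.mem 2) (s.mem 3) ((List.range j).filter fun e => 0 < s.mem 4 e))
      ?_ ?_ ⟨rfl, rfl, rfl, by decide, by decide⟩ hB hmB ?_ ?_) fun s1 hs1 hF1 =>
      Runs.add ?_))))))).le ?_
  · simp [State.setReg_reg, hm]
  · simp [State.setReg_reg, h1]
  · simp [State.setReg_reg, h1, endpoints]
  · intro j s' hj hI hF hji
    have e1 : s'.reg 1 = 1 := by rw [hF.reg 1 rfl]; simp [State.setReg_reg, h1]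
    have e2 : s'.reg 2 = 0 := by rw [hF.reg 2 rfl]; simp [State.setReg_reg, h2]
    have f2 : s'.mem 2 = s.mem 2 := by rw [hF.mem 2 rfl]; simp [State.setMem_mem]
    have f3 : s'.mem 3 = s.mem 3 := by rw [hF.mem 3 rfl]; simp [State.setMem_mem]
    have f4 : s'.mem 4 = s.mem 4 := by rw [hF.mem 4 rfl]; simp [State.setMem_mem]
    refine (Runs.seq1 (Runs.load (Runs.ifLt (fun h => Runs.seq1 (Runs.load (Runs.seq1 (Runs.store
      (Runs.seq1 (Runs.add (Runs.seq1 (Runs.load (Runs.seq1 (Runs.store (Runs.add ?_)))))))))))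
      fun h => Runs.le (T' := 6) (Runs.const ?_) (by norm_num)))).le (by norm_num)
    · simp [State.setReg_reg, hji, e2, f4] at h
      have a := map_range_succ_update (v := s.mem 3 j)
        (map_range_succ_update (v := s.mem 2 j) hI)
      rw [List.range_succ, List.filter_append]
      simp [State.setReg_reg, State.setMem_mem, hji, e1, f2, f3, h, endpoints] at a ⊢
      exact a
    · simp [State.setReg_reg, hji, e2, f4] at h
      rw [List.range_succ, List.filter_append]
      simp [State.setReg_reg, h, hI]
  · have e2 : s1.reg 2 = 0 := by rw [hF1.reg 2 rfl]; simp [State.setReg_reg, h2]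
    rw [← hs1]
    simp [State.output, e2]
  · norm_num; omega

end

/-- Two obstructions set the flag: a positive lower bound together with a colour that does not
occur, or the absence of a solution word for the occurring colours. -/
theorem runs_checkSolvable {I : Instance} {k : ℕ+} {B : ℕ} {s : State} (hP : Prepared I k B s) :
    Runs .checkSolvable s (480 * B ^ 6) fun s' =>
      s'.reg 60 = 0 ∧ I.HasSolution k ∨ s'.reg 60 = 1 ∧ ¬ I.HasSolution k := by
  have hB : 1 ≤ B := by have := hP.ready.dim_le; omega
  have hBB : 1 ≤ B ^ 6 := Nat.one_le_pow _ _ hB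
  have hsol := hP.tables.hasSolution_iff k
  have hlt : (0 < (k : ℕ) * I.α.num.toNat ∧ s.reg 16 < I.ℓ) ↔
      s.reg 2 < s.reg 6 ∧ s.reg 16 < s.reg 4 := by
    rw [hP.colours, hP.bound, hP.ready.zero]
  refine (Runs.seq1 (Runs.const (Runs.seq_of (T₁ := 3)
    (Q' := fun s' => s'.reg 60 = if s.reg 2 < s.reg 6 ∧ s.reg 16 < s.reg 4 then 1 else 0) ?_
    fun s1 hs1 hF1 => Runs.seq_of (runs_solvable (B := B) (k := k) (m := s.reg 15)
      (r := s.reg 16) ?_ ?_)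
    fun s2 hs2 hF2 => Runs.ifLt (T := 1) (fun h => Runs.const ?_) fun h => Runs.const ?_))).le ?_
  · refine Runs.ifLt (T := 2) (fun h => Runs.ifLt (T := 1) (fun h' => Runs.const ?_)
      fun h' => Runs.const ?_) fun h => Runs.le (T := 1) (Runs.const ?_) (by norm_num)
    · simp [State.setReg_reg] at h h' ⊢
      exact ⟨h, h'⟩
    · simp [State.setReg_reg] at h h' ⊢
      omega
    · simp [State.setReg_reg] at h ⊢
      omega
  · exact (hP.ready.setReg (x := 60) (by norm_num) 0).frame hF1 rfl rfl rfl
  · have e6 := hF1.mem 6 rfl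
    rw [State.setReg_mem] at e6
    rw [e6]
    exact hP.tables.colour.inj
  pick_goal 3
  · omega
  all_goals
    have hR1 := (hP.ready.setReg (x := 60) (by norm_num) 0).frame hF1 rfl rfl rfl
    have hone : s2.reg 1 = 1 := by rw [hF2.reg 1 rfl, hR1.one]
    have hadm : admissible s1 = I.allowed k := by
      rw [← hP.admissible_eq]
      funext i
      simp [admissible, State.setReg_reg, hF1.reg 6 rfl, hF1.reg 7 rfl, hF1.reg 8 rfl,
        hF1.reg 9 rfl]
    rw [hadm, hF1.mem 2 rfl, hF1.mem 3 rfl, hF1.mem 4 rfl, hF1.mem 6 rfl, State.setReg_mem] at hs2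
    have e60 : s2.reg 60 = s1.reg 60 := hF2.reg 60 rfl
  · refine Or.inr ⟨by simp, fun hs => ?_⟩
    rcases hs2 with hs2 | hs2
    · omega
    · exact hs2.2 (hsol.1 hs).2
  · rw [State.setReg_reg_of_ne _ _ (by decide), e60, hs1, hsol, hlt]
    rcases hs2 with hs2 | hs2
    · by_cases hc : s.reg 2 < s.reg 6 ∧ s.reg 16 < s.reg 4
      · exact Or.inr ⟨if_pos hc, fun hh => hh.1 hc⟩
      · exact Or.inl ⟨if_neg hc, hc, hs2.2⟩
    · omega

theorem runs_findMatching (I : Instance) (k : ℕ+) {B : ℕ} (hZ : 2 ^ ((k : ℕ) * 2 * 2 + 1) ≤ B)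
    (hn : I.n ≤ B) (hnn : I.n * I.n ≤ B) :
    Runs .findMatching (State.init (I.encode k)) (1100 * B ^ 7)
      fun s' => I.IsCorrectOutput k s'.output := by
  have hB : 1 ≤ B := (Nat.one_le_two_pow).trans hZ
  have hB1 : B ≤ B ^ 7 := Nat.le_self_pow (by norm_num) B
  have hB2 : B ^ 2 ≤ B ^ 7 := Nat.pow_le_pow_right hB (by norm_num)
  have hB6 : B ^ 6 ≤ B ^ 7 := Nat.pow_le_pow_right hB (by norm_num)
  refine (Runs.seq_of (runs_prepare I k hZ hn hnn) fun s1 hP hF1 => Runs.seq_of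
    (runs_checkSolvable hP) fun s2 hs2 hF2 => Runs.ifLt (T := 500 * B ^ 7)
    (fun h => Runs.le (T := 1) (Runs.const ?_) (by omega)) fun h => ?_).le (by omega)
  · have e2 : s2.reg 2 = 0 := by rw [hF2.reg 2 rfl, hP.ready.zero]
    refine Or.inr ⟨hs2.elim (fun h' => absurd h (by rw [h'.1]; omega)) fun h' => h'.2, ?_⟩
    -- Array `1` has not been written so far, so an output of length one is `[0]`.
    simp [State.output, hF2.mem 1 rfl, hP.output]
  · have e2 : s2.reg 2 = 0 := by rw [hF2.reg 2 rfl, hP.ready.zero]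
    have hsol : I.HasSolution k := hs2.elim (fun h' => h'.2) fun h' => absurd h'.1 (by omega)
    obtain ⟨hr, hw⟩ := (hP.tables.hasSolution_iff k).1 hsol
    have hR2 := hP.ready.frame hF2 rfl rfl rfl
    have hadm : admissible s2 = I.allowed k := by
      rw [← hP.admissible_eq]
      funext i
      simp [admissible, hF2.reg 6 rfl, hF2.reg 7 rfl, hF2.reg 8 rfl, hF2.reg 9 rfl]
    have e6 : s2.mem 6 = s1.mem 6 := hF2.mem 6 rfl
    have e4 : s2.mem 4 = s1.mem 4 := hF2.mem 4 rfl
    have e3 : s2.mem 3 = s1.mem 3 := hF2.mem 3 rfl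
    have e2' : s2.mem 2 = s1.mem 2 := hF2.mem 2 rfl
    refine (Runs.seq_of (runs_reduceEdges (B := B) hR2 ?_ ?_ ?_) fun s3 hs3 hF3 =>
      (runs_writeEdges (B := B) (m := s1.reg 15) ?_ ?_ ?_ hB hR2.edges_le).mono le_rfl ?_).le
      (by omega)
    · rw [e6]; exact hP.tables.colour.inj
    · rw [e6]; exact fun q hq => hP.tables.colour_ne_zero hq
    · rw [hadm, e6, e4, e3, e2']; exact hw
    · rw [hF3.reg 1 rfl, hR2.one]
    · rw [hF3.reg 2 rfl, hR2.zero]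
    · rw [hF3.reg 15 rfl, hR2.edges]
    · intro s4 hs4 _
      rw [hadm, e6, e4, e3, e2'] at hs3
      -- The word found in the reduced instance is transported back to the original colours before
      -- it is read as a matching.
      obtain ⟨L, hL1, hL2, hL3, hL4⟩ := hP.tables.balanced_of_isSolutionWord k.pos
        (hs3.2.of_delete (fun q hq => hP.tables.colour_ne_zero hq) fun e _ => hs3.1 e) hr
      refine Or.inl ⟨L, hL1, hL2, hL3, ?_⟩
      rw [hs4, hF3.mem 2 rfl, hF3.mem 3 rfl, e2', e3, hL4]

theorem exists_findMatching : ∃ c : ℕ, ∀ (I : Instance) (k : ℕ+), ∃ (t : ℕ) (y : List ℕ),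
    Prog.findMatching.Outputs (I.encode k) t y ∧
      t ≤ c * 2 ^ (c * (k : ℕ)) * (I.n + 1) ^ c ∧ I.IsCorrectOutput k y := by
  -- With `B` as below, `1100 * B ^ 7` equals `1100 * 2 ^ 7 * 2 ^ (28 * k) * (n + 1) ^ 14`. The
  -- leading factor exceeds `28` and `14` and so serves for both exponents too.
  refine ⟨1100 * 2 ^ 7, fun I k => ?_⟩
  have h1 : 1 ≤ (I.n + 1) ^ 2 := Nat.one_le_pow _ _ (by omega)
  have h2 : 1 ≤ 2 ^ ((k : ℕ) * 2 * 2 + 1) := Nat.one_le_two_pow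
  have h3 : (I.n + 1) ^ 2 = I.n * I.n + 2 * I.n + 1 := by ring
  have h4 : (I.n + 1) ^ 2 ≤ 2 ^ ((k : ℕ) * 2 * 2 + 1) * (I.n + 1) ^ 2 :=
    Nat.le_mul_of_pos_left _ h2
  obtain ⟨t, s', he, ht, hQ⟩ := runs_findMatching I k
    (B := 2 ^ ((k : ℕ) * 2 * 2 + 1) * (I.n + 1) ^ 2)
    (Nat.le_mul_of_pos_right _ h1) (by omega) (by omega)
  refine ⟨t, _, ⟨s', he, rfl⟩, ht.trans ?_, hQ⟩
  have h5 : 1100 * (2 ^ ((k : ℕ) * 2 * 2 + 1) * (I.n + 1) ^ 2) ^ 7 =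
      1100 * 2 ^ 7 * 2 ^ (28 * (k : ℕ)) * (I.n + 1) ^ 14 := by ring
  rw [h5]
  gcongr <;> norm_num

/-- The input contains the whole adjacency matrix, so `n + 1` is at most its length and the time
bound of the search carries over. -/
theorem isFPT_hasSolution : IsFPT (fun x : Instance × ℕ+ => x.1.encode x.2)
    (fun x => (x.2 : ℕ)) (fun x => x.1.HasSolution x.2) := by
  obtain ⟨c, hc⟩ := exists_findMatching
  -- Setting register `0` to `1` cuts the output down to its first word, which is already the
  -- answer. The extra step is absorbed by `c + 1`.
  refine ⟨.seq .findMatching (.const 0 1), fun k => (c + 1) * 2 ^ (c * k), c, ?_, ?_⟩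
  · have hpow : Primrec fun k : ℕ => 2 ^ (c * k) := by
      have h : Primrec fun n : ℕ => n.rec (motive := fun _ => ℕ) 1 fun _ b => 2 * b :=
        Primrec.nat_rec₁ 1 (Primrec.nat_mul.comp (Primrec.const 2) Primrec.snd).to₂
      have h' : Primrec fun n : ℕ => 2 ^ n := h.of_eq fun n => by
        induction n with
        | zero => rfl
        | succ n ih => rw [pow_succ, ← ih, mul_comm]
      exact h'.comp (Primrec.nat_mul.comp (Primrec.const c) Primrec.id)
    exact (Primrec.nat_mul.comp (Primrec.const _) hpow).to_comp
  · rintro ⟨I, k⟩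
    obtain ⟨t, y, ⟨s, he, hy⟩, ht, hcor⟩ := hc I k
    refine ⟨t + 1, [s.mem 1 0], ⟨_, he.seq (Exec.const _ _ _), ?_⟩, ?_, ?_⟩
    · simp [State.output]
    · have hlen : I.n + 1 ≤ (I.encode k).length := by
        simp only [Instance.encode, List.length_append, List.length_cons, List.length_nil,
          List.length_ofFn]
        have : I.n ≤ I.n * I.n := Nat.le_mul_self _
        omega
      have h1 : 1 ≤ 2 ^ (c * (k : ℕ)) * (I.encode k).length ^ c :=
        Nat.mul_pos (by positivity) (Nat.pow_pos (by omega))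
      calc t + 1 ≤ c * 2 ^ (c * (k : ℕ)) * (I.encode k).length ^ c +
            2 ^ (c * (k : ℕ)) * (I.encode k).length ^ c := by
            refine add_le_add (ht.trans ?_) h1
            gcongr
        _ = (c + 1) * 2 ^ (c * (k : ℕ)) * (I.encode k).length ^ c := by ring
    · have hhead : ∀ a l, y = a :: l → s.mem 1 0 = a := by
        intro a l hal
        rw [← hy, State.output] at hal
        cases hN : s.reg 0 with
        | zero => simp [hN] at hal
        | succ N =>
          rw [hN, List.range_succ_eq_map, List.map_cons] at hal
          exact (List.cons.inj hal).1
      rcases hcor with ⟨L, h1, h2, h3, h4⟩ | ⟨h1, h2⟩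
      · refine Or.inl ⟨⟨_, h3, ?_⟩, by rw [hhead _ _ h4]⟩
        rw [List.toFinset_card_of_nodup h2, List.length_map, h1]
      · exact Or.inr ⟨h1, by rw [hhead _ _ h2]⟩

end FairMatching

theorem mainTheorem3 :
    (∃ (p : FairMatching.Prog) (c : ℕ), ∀ (I : FairMatching.Instance) (k : ℕ+),
      ∃ (t : ℕ) (y : List ℕ),
        p.Outputs (I.encode k) t y ∧
        t ≤ c * 2 ^ (c * (k : ℕ)) * (I.n + 1) ^ c ∧
        I.IsCorrectOutput k y) ∧
    FairMatching.IsFPT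
      (fun x : FairMatching.Instance × ℕ+ => x.1.encode x.2)
      (fun x => (x.2 : ℕ))
      (fun x => x.1.HasSolution x.2) :=
  ⟨⟨.findMatching, FairMatching.exists_findMatching⟩, FairMatching.isFPT_hasSolution⟩
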